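/- Let $p,q\ge 1$ be integers, $X=\{1,\dots,p+q\}\cup\{-1,\dots,-(p+q)\}$, and $$\gamma=(1,\dots,p,-1,\dots,-p)\,(p+1,\dots,p+q,-(p+1),\dots,-(p+q)),$$ a permutation of $X$. For permutations $\sigma,\tau$ of $X$ let $\#(\tau)$ be the number of orbits of $\tau$ on $X$, and $\#(\tau,\sigma)$ the number of orbits on $X$ of the group generated by $\tau$ and $\sigma$. Let $\mathcal S^B_{nc}(p,q)$ be the set of permutations $\tau$ of $X$ with $\tau(-i)=-\tau(i)$ for all $i\in X$ and $$\#(\tau)+\#(\tau^{-1}\gamma)+\#(\gamma)=|X|+2\,\#(\tau,\gamma).$$ For such $\tau$ let $\widetilde\Omega(\tau)$ be the partition of $X$ obtained from the partition into orbits of $\tau$ by merging all orbits $A$ with $A=-A$ (if there are any) into a single block. Put $NC^B(p,q)=\{\widetilde\Omega(\tau):\tau\in\mathcal S^B_{nc}(p,q)\}$, partially ordered by reverse refinement: $\pi\le\rho$ if and only if every block of $\rho$ is a union of blocks of $\pi$. **Theorem 1.5.** For every integer $n\ge 2$ the poset $NC^B(n-1,1)$ is a lattice. Its meet operation is the restriction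 of the meet operation on the lattice of all partitions of $\{1,\dots,n\}\cup\{-1,\dots,-n\}$; that is, for $\pi,\rho\in NC^B(n-1,1)$, the blocks of the meet $\pi\wedge\rho\in NC^B(n-1,1)$ are precisely the non-empty intersections $A\cap B$, where $A$ is a block of $\pi$ and $B$ is a block of $\rho$. -/

import Mathlib

/-- The set `{1, …, n} ∪ {-1, …, -n}`. -/
abbrev SignedSet (n : ℕ) : Type := {x : ℤ // x ≠ 0 ∧ |x| ≤ (n : ℤ)}

namespace SignedSet

instance (n : ℕ) : Neg (SignedSet n) :=
  ⟨fun x => ⟨-x.1, neg_ne_zero.mpr x.2.1, by rw [abs_neg]; exact x.2.2⟩⟩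

instance (n : ℕ) : Finite (SignedSet n) :=
  ((Set.finite_Icc (-(n : ℤ)) n).subset
    (fun _ hx => abs_le.mp hx.2) : {x : ℤ | x ≠ 0 ∧ |x| ≤ (n : ℤ)}.Finite).to_subtype

end SignedSet

namespace AnnularB

/-- The hyperoctahedral group `B_n`: permutations `τ` of `{±1, …, ±n}` with `τ(-i) = -τ(i)`. -/
def hyperoctahedral (n : ℕ) : Set (Equiv.Perm (SignedSet n)) :=
  {τ | ∀ x, τ (-x) = -τ x}

/-- The number of orbits of a permutation `τ`. -/
noncomputable def numOrbits {X : Type*} (τ : Equiv.Perm X) : ℕ :=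
  Nat.card (Quotient (Equiv.Perm.SameCycle.setoid τ))

/-- The number of orbits of the subgroup generated by `τ` and `γ`. -/
noncomputable def numJointOrbits {X : Type*} (τ γ : Equiv.Perm X) : ℕ :=
  Nat.card (MulAction.orbitRel.Quotient (Subgroup.closure {τ, γ}) X)

/-- Non-crossing (genus zero) permutations of a finite set `X` with respect to `γ`. -/
def ncPerms {X : Type*} (γ : Equiv.Perm X) : Set (Equiv.Perm X) :=
  {τ | numOrbits τ + numOrbits (τ⁻¹ * γ) + numOrbits γ = Nat.card X + 2 * numJointOrbits τ γ}

/-- The values of `γ = (1, …, p, -1, …, -p) (p+1, …, p+q, -(p+1), …, -(p+q))` on integers. -/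
def gammaFun (p q : ℕ) (x : ℤ) : ℤ :=
  if x = p then -1
  else if x = -p then 1
  else if x = p + q then -(p + 1)
  else if x = -(p + q) then p + 1
  else if 0 < x then x + 1 else x - 1

/-- The values of the inverse of `γ`. -/
def gammaInvFun (p q : ℕ) (x : ℤ) : ℤ :=
  if x = p + 1 then -(p + q)
  else if x = -(p + 1) then p + q
  else if x = 1 then -p
  else if x = -1 then p
  else if 0 < x then x - 1 else x + 1

/-- The permutation
`γ = (1, …, p, -1, …, -p) (p+1, …, p+q, -(p+1), …, -(p+q))` of `{±1, …, ±(p+q)}`. -/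
def gamma (p q : ℕ) : Equiv.Perm (SignedSet (p + q)) where
  toFun x := ⟨gammaFun p q x.1, by
    obtain ⟨x, h0, h1⟩ := x
    replace h1 := abs_le.mp h1
    push_cast at h1
    suffices h : gammaFun p q x ≠ 0 ∧ -((p : ℤ) + q) ≤ gammaFun p q x ∧ gammaFun p q x ≤ p + q from
      ⟨h.1, abs_le.mpr (by push_cast; exact h.2)⟩
    unfold gammaFun
    split_ifs <;> omega⟩
  invFun x := ⟨gammaInvFun p q x.1, by
    obtain ⟨x, h0, h1⟩ := x
    replace h1 := abs_le.mp h1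
    push_cast at h1
    suffices h : gammaInvFun p q x ≠ 0 ∧ -((p : ℤ) + q) ≤ gammaInvFun p q x ∧ gammaInvFun p q x ≤ p + q from
      ⟨h.1, abs_le.mpr (by push_cast; exact h.2)⟩
    unfold gammaInvFun
    split_ifs <;> omega⟩
  left_inv x := by
    obtain ⟨x, h0, h1⟩ := x
    rw [abs_le] at h1
    push_cast at h1
    apply Subtype.ext
    change gammaInvFun p q (gammaFun p q x) = x
    unfold gammaFun
    split_ifs <;> unfold gammaInvFun <;> split_ifs <;> first | omega | contradiction
  right_inv x := by
    obtain ⟨x, h0, h1⟩ := x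
    rw [abs_le] at h1
    push_cast at h1
    apply Subtype.ext
    change gammaFun p q (gammaInvFun p q x) = x
    unfold gammaInvFun
    split_ifs <;> unfold gammaFun <;> split_ifs <;> omega

/-- Annular non-crossing permutations of type B. -/
def ncPermsB (p q : ℕ) : Set (Equiv.Perm (SignedSet (p + q))) :=
  ncPerms (gamma p q) ∩ hyperoctahedral (p + q)

/-- The orbit of `x` under `τ` is a zero-block, that is, it equals its own negative. -/
def InZeroBlock {n : ℕ} (τ : Equiv.Perm (SignedSet n)) (x : SignedSet n) : Prop :=
  (fun y => -y) '' {y | τ.SameCycle x y} = {y | τ.SameCycle x y}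

/-- The partition obtained from the partition of `{±1, …, ±n}` into orbits of `τ` by merging
all zero-blocks into one block. Partitions are encoded as equivalence relations; the blocks of
`π` are the elements of `π.classes`. -/
def omegaTilde {n : ℕ} (τ : Equiv.Perm (SignedSet n)) : Setoid (SignedSet n) where
  r x y := τ.SameCycle x y ∨ (InZeroBlock τ x ∧ InZeroBlock τ y)
  iseqv := by
    have key : ∀ {x y : SignedSet n}, τ.SameCycle x y → InZeroBlock τ x → InZeroBlock τ y := by
      intro x y h hx
      have e : {z | τ.SameCycle y z} = {z | τ.SameCycle x z} :=
        Set.ext fun z => ⟨fun hz => h.trans hz, fun hz => h.symm.trans hz⟩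
      unfold InZeroBlock
      rw [e]
      exact hx
    refine ⟨fun x => Or.inl (Equiv.Perm.SameCycle.refl τ x), ?_, ?_⟩
    · rintro x y (h | ⟨hx, hy⟩)
      · exact Or.inl h.symm
      · exact Or.inr ⟨hy, hx⟩
    · rintro x y z (h | ⟨hx, hy⟩) (h' | ⟨hy', hz⟩)
      · exact Or.inl (h.trans h')
      · exact Or.inr ⟨key h.symm hy', hz⟩
      · exact Or.inr ⟨hx, key h' hy⟩
      · exact Or.inr ⟨hx, hz⟩

/-- The set `NC^B(p,q)` of annular non-crossing partitions of type B. -/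
def NCB (p q : ℕ) : Type :=
  {π : Setoid (SignedSet (p + q)) // ∃ τ ∈ ncPermsB p q, omegaTilde τ = π}

/-- Reverse refinement: every block of `ρ` is a union of blocks of `π`. -/
def RevRefines {X : Type*} (π ρ : Setoid X) : Prop :=
  ∀ B ∈ ρ.classes, ∃ S ⊆ π.classes, B = ⋃₀ S

theorem revRefines_iff_le {X : Type*} (π ρ : Setoid X) : RevRefines π ρ ↔ π ≤ ρ := by
  constructor
  · intro h x y hxy
    obtain ⟨S, hS, e⟩ := h {z | ρ z y} (Setoid.mem_classes ρ y)
    have hy : y ∈ ⋃₀ S := e ▸ (ρ.refl y : ρ y y)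
    obtain ⟨A, hA, hyA⟩ := hy
    obtain ⟨a, rfl⟩ := hS hA
    have hx : x ∈ ⋃₀ S := ⟨_, hA, π.trans hxy hyA⟩
    rw [← e] at hx
    exact hx
  · rintro h B ⟨b, rfl⟩
    refine ⟨{A | A ∈ π.classes ∧ A ⊆ {z | ρ z b}}, fun A hA => hA.1, ?_⟩
    ext z
    constructor
    · intro hz
      exact ⟨{w | π w z}, ⟨Setoid.mem_classes π z, fun w hw => ρ.trans (h hw) hz⟩, π.refl z⟩
    · rintro ⟨A, ⟨_, hA⟩, hzA⟩
      exact hA hzA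

/-- `NC^B(p,q)` is partially ordered by reverse refinement. -/
instance instPartialOrderNCB (p q : ℕ) : PartialOrder (NCB p q) where
  le π ρ := RevRefines π.1 ρ.1
  le_refl π := (revRefines_iff_le _ _).mpr le_rfl
  le_trans π ρ σ h h' := (revRefines_iff_le _ _).mpr
    (((revRefines_iff_le _ _).mp h).trans ((revRefines_iff_le _ _).mp h'))
  le_antisymm π ρ h h' := Subtype.ext
    (le_antisymm ((revRefines_iff_le _ _).mp h) ((revRefines_iff_le _ _).mp h'))

end AnnularB

/-! Write `p = n - 1`. The long cycle of `γ` is a circle of `2 * p` points on which negation is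
rotation by `p`; the short cycle is `{inner p, -inner p}`. If `τ` preserves the two cycles of `γ`,
the genus condition says that `τ` lies in the interval `[1, γ]` of the absolute order. Otherwise
both sides of the genus equation are smaller by two, and `τ` arises from a symmetric `σ` in `[1, γ]`
fixing `±inner p`, by attaching these two points at opposite points of one symmetric cycle of the
Kreweras complement `σ⁻¹ γ` (`absLe_or_exists_attachInner`).

On the level of partitions this gives an intrinsic description, `IsAdmissible`: symmetry, at most
one zero-block, and noncrossing on the circle both before and after the blocks of `inner p` and
`-inner p` are merged. Necessity is `isAdmissible_omegaTilde`; sufficiency is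
`IsAdmissible.exists_omegaTilde_eq`, which rests on realising noncrossing partitions by elements of
`[1, γ]` (`Noncrossing.exists_absLe`).

Admissibility is stable under intersection. Only the condition on merged blocks is not immediate:
the two partitions might resolve a crossing with opposite signs, and
`IsAdmissible.rel_neg_of_crossing` shows that then one of them has `inner p` in its zero-block, so
that its sign can be changed. Thus meets are intersections, and a finite poset with binary meets and
a greatest element is a lattice. -/

namespace AnnularB

open Equiv Equiv.Perm

/-! ### Merging two classes of an equivalence relation. -/

section Join

variable {X : Type*}

/-- The equivalence relation obtained from `r` by merging the classes of `a` and `b`. -/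
def joinSetoid (r : Setoid X) (a b : X) : Setoid X where
  r u v := r u v ∨ ((r a u ∨ r b u) ∧ (r a v ∨ r b v))
  iseqv := by
    refine ⟨fun x => Or.inl (r.refl x), ?_, ?_⟩
    · rintro x y (h | ⟨h, h'⟩)
      · exact Or.inl (r.symm h)
      · exact Or.inr ⟨h', h⟩
    · rintro x y z (h | ⟨h, h'⟩) (k | ⟨k, k'⟩)
      · exact Or.inl (r.trans h k)
      · exact Or.inr ⟨k.imp (fun t => r.trans t (r.symm h)) (fun t => r.trans t (r.symm h)), k'⟩
      · exact Or.inr ⟨h, h'.imp (fun t => r.trans t k) (fun t => r.trans t k)⟩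
      · exact Or.inr ⟨h, k'⟩

theorem joinSetoid_apply {r : Setoid X} {a b u v : X} :
    joinSetoid r a b u v ↔ r u v ∨ ((r a u ∨ r b u) ∧ (r a v ∨ r b v)) := Iff.rfl

theorem joinSetoid_rel (r : Setoid X) (a b : X) : joinSetoid r a b a b :=
  Or.inr ⟨Or.inl (r.refl a), Or.inr (r.refl b)⟩

theorem joinSetoid_le {r s : Setoid X} {a b : X} (h : r ≤ s) (hab : s a b) :
    joinSetoid r a b ≤ s := by
  rintro u v (k | ⟨k, k'⟩)
  · exact h k
  · have e : ∀ {w}, r a w ∨ r b w → s a w := by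
      rintro w (t | t)
      · exact h t
      · exact s.trans hab (h t)
    exact s.trans (s.symm (e k)) (e k')

theorem card_quotient_joinSetoid [Finite X] (r : Setoid X) {a b : X} (h : ¬ r a b) :
    Nat.card (Quotient r) = Nat.card (Quotient (joinSetoid r a b)) + 1 := by
  classical
  let qb : Quotient r := Quotient.mk r b
  let f : {q : Quotient r // q ≠ qb} → Quotient (joinSetoid r a b) := fun q =>
    Quotient.map' (s₁ := r) (s₂ := joinSetoid r a b) id (fun _ _ t => Or.inl t) q.1
  have hf : Function.Bijective f := by
    constructor
    · rintro ⟨q, hq⟩ ⟨q', hq'⟩ e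
      induction q using Quotient.inductionOn with | _ u
      induction q' using Quotient.inductionOn with | _ v
      have hu : ¬ r b u := fun t => hq (Quotient.sound (s := r) (r.symm t))
      have hv : ¬ r b v := fun t => hq' (Quotient.sound (s := r) (r.symm t))
      have e' : joinSetoid r a b u v := Quotient.exact e
      refine Subtype.ext (Quotient.sound (s := r) ?_)
      rcases e' with t | ⟨t, t'⟩
      · exact t
      · exact r.trans (r.symm (t.resolve_right hu)) (t'.resolve_right hv)
    · intro q
      induction q using Quotient.inductionOn with | _ u
      by_cases hu : r b u
      · refine ⟨⟨Quotient.mk r a, fun t => h (Quotient.exact t)⟩, ?_⟩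
        exact Quotient.sound (s := joinSetoid r a b)
          (Or.inr ⟨Or.inl (r.refl a), Or.inr hu⟩)
      · exact ⟨⟨Quotient.mk r u, fun t => hu (r.symm (Quotient.exact t))⟩, rfl⟩
  rw [← Nat.card_eq_of_bijective f hf, ← Finite.card_option]
  exact (Nat.card_congr (Equiv.optionSubtypeNe qb)).symm

theorem card_quotient_eq_one (r : Setoid X) (a : X) (h : ∀ x, r a x) :
    Nat.card (Quotient r) = 1 := by
  rw [Nat.card_eq_one_iff_unique]
  refine ⟨⟨fun q q' => ?_⟩, ⟨Quotient.mk r a⟩⟩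
  induction q using Quotient.inductionOn with | _ u
  induction q' using Quotient.inductionOn with | _ v
  exact Quotient.sound (s := r) (r.trans (r.symm (h u)) (h v))

theorem card_quotient_eq_two [Finite X] (r : Setoid X) (a b : X) (hab : ¬ r a b)
    (h : ∀ x, r a x ∨ r b x) : Nat.card (Quotient r) = 2 := by
  rw [card_quotient_joinSetoid r hab, card_quotient_eq_one _ a]
  exact fun x => Or.inr ⟨Or.inl (r.refl a), h x⟩

end Join

/-! ### Orbits of a permutation multiplied by a transposition. -/

section Perm

variable {X : Type*}

theorem sameCycle_setoid_le {f : Perm X} {r : Setoid X} (h : ∀ u, r u (f u)) :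
    SameCycle.setoid f ≤ r := by
  have hn : ∀ (n : ℕ) (u : X), r u ((f ^ n) u) := by
    intro n
    induction n with
    | zero => exact fun u => r.refl u
    | succ n ih => exact fun u => r.trans (ih u) (by rw [pow_succ']; exact h _)
  rintro u v ⟨k, rfl⟩
  obtain ⟨n, rfl | rfl⟩ := k.eq_nat_or_neg
  · exact hn n u
  · have := hn n ((f ^ (-(n : ℤ))) u)
    rw [← zpow_natCast, ← Perm.mul_apply, ← zpow_add, add_neg_cancel] at this
    exact r.symm this

theorem numOrbits_one [Finite X] : numOrbits (1 : Perm X) = Nat.card X := by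
  refine (Nat.card_eq_of_bijective (Quotient.mk (SameCycle.setoid (1 : Perm X)))
    ⟨fun u v h => ?_, Quotient.mk_surjective⟩).symm
  exact sameCycle_one.mp (Quotient.exact h)

theorem numOrbits_le_card [Finite X] (w : Perm X) : numOrbits w ≤ Nat.card X :=
  Nat.card_le_card_of_surjective _ (Quotient.mk_surjective (s := SameCycle.setoid w))

variable [DecidableEq X]

theorem sameCycle_swap_mul_le (w : Perm X) (a b : X) :
    SameCycle.setoid (swap a b * w) ≤ joinSetoid (SameCycle.setoid w) a b := by
  refine sameCycle_setoid_le fun u => ?_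
  have h1 : SameCycle w u (w u) := sameCycle_apply_right.mpr (SameCycle.refl w u)
  rw [Perm.mul_apply, swap_apply_def]
  split_ifs with h h'
  · exact Or.inr ⟨Or.inl (h ▸ h1.symm), Or.inr (SameCycle.refl w b)⟩
  · exact Or.inr ⟨Or.inr (h' ▸ h1.symm), Or.inl (SameCycle.refl w a)⟩
  · exact Or.inl h1

theorem swap_mul_pow_apply {c : Perm X} {a b x : X} {m : ℕ}
    (h : ∀ j, 0 < j → j ≤ m → (c ^ j) x ≠ a ∧ (c ^ j) x ≠ b) :
    ∀ j ≤ m, ((swap a b * c) ^ j) x = (c ^ j) x := by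
  intro j
  induction j with
  | zero => simp
  | succ j ih =>
    intro hj
    have h' := h (j + 1) j.succ_pos hj
    rw [pow_succ', Perm.mul_apply] at h'
    rw [pow_succ', Perm.mul_apply, ih (by omega), Perm.mul_apply, pow_succ', Perm.mul_apply]
    exact swap_apply_of_ne_of_ne h'.1 h'.2

/-- If `k` is the first positive time at which the `c`-orbit of `x` visits `z`, then the cycle of
`x` under `swap x z * c` starts with the arc `x, c x, …, c^(k-1) x`. -/
theorem swap_mul_pow_apply_of_first {c : Perm X} {x z : X} {k : ℕ} (hz : (c ^ k) x = z)
    (hk : ∀ j, 0 < j → j < k → (c ^ j) x ≠ z) {j : ℕ} (hj : j < k) :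
    ((swap x z * c) ^ j) x = (c ^ j) x := by
  refine swap_mul_pow_apply (m := k - 1) (fun i hi hik => ⟨fun h => ?_, hk i hi (by omega)⟩) j
    (by omega)
  refine hk (k - i) (by omega) (by omega) ?_
  rw [← hz, ← Nat.sub_add_cancel (show i ≤ k by omega), pow_add, Perm.mul_apply, h]
  simp

theorem sameCycle_swap_mul_of_first {c : Perm X} {x z : X} {k : ℕ} (hz : (c ^ k) x = z)
    (hk : ∀ j, 0 < j → j < k → (c ^ j) x ≠ z) {j : ℕ} (hj : j < k) :
    SameCycle (swap x z * c) x ((c ^ j) x) := by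
  rw [← swap_mul_pow_apply_of_first hz hk hj]
  exact sameCycle_pow_right.mpr (SameCycle.refl _ _)

theorem exists_first_pow [Finite X] {c : Perm X} {x z : X} (h : SameCycle c x z) :
    ∃ k, 0 < k ∧ (c ^ k) x = z ∧ ∀ j, 0 < j → j < k → (c ^ j) x ≠ z := by
  have h' : ∃ k, 0 < k ∧ (c ^ k) x = z := by
    obtain ⟨i, hi, -, e⟩ := h.exists_pow_eq''
    exact ⟨i, hi, e⟩
  classical
  refine ⟨Nat.find h', (Nat.find_spec h').1, (Nat.find_spec h').2, fun j hj hjk e => ?_⟩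
  exact Nat.find_min h' hjk ⟨hj, e⟩

/-- The transposition redirects the step that first reaches `z` back to `x`, so the arc before `z`
closes up into a cycle of length `k` that misses `z`. -/
theorem not_sameCycle_swap_mul [Finite X] {c : Perm X} {x z : X} (h : SameCycle c x z)
    (hxz : x ≠ z) : ¬ SameCycle (swap x z * c) x z := by
  obtain ⟨k, hk0, hz, hk⟩ := exists_first_pow h
  have hr : ((swap x z * c) ^ k) x = x := by
    obtain ⟨m, rfl⟩ : ∃ m, k = m + 1 := ⟨k - 1, by omega⟩
    rw [pow_succ', Perm.mul_apply, swap_mul_pow_apply_of_first hz hk m.lt_succ_self, Perm.mul_apply,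
      ← Perm.mul_apply c, ← pow_succ', hz, swap_apply_right]
  have hmul : ∀ q : ℕ, ((swap x z * c) ^ (k * q)) x = x := by
    intro q
    induction q with
    | zero => simp
    | succ q ih => rw [Nat.mul_succ, pow_add, Perm.mul_apply, hr, ih]
  intro hs
  obtain ⟨i, e⟩ := hs.exists_nat_pow_eq
  rw [← Nat.mod_add_div i k, pow_add, Perm.mul_apply, hmul,
    swap_mul_pow_apply_of_first hz hk (Nat.mod_lt i hk0)] at e
  rcases Nat.eq_zero_or_pos (i % k) with h0 | h0
  · rw [h0] at e
    exact hxz e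
  · exact hk _ h0 (Nat.mod_lt i hk0) e

/-- The step by which the cycle of `x` first returns to `x` is redirected to `z`. -/
theorem sameCycle_swap_mul [Finite X] {c : Perm X} {x z : X} (h : ¬ SameCycle c x z) :
    SameCycle (swap x z * c) x z := by
  obtain ⟨k, hk0, hx, hk⟩ := exists_first_pow (SameCycle.refl c x)
  obtain ⟨m, rfl⟩ : ∃ m, k = m + 1 := ⟨k - 1, by omega⟩
  have e : ((swap x z * c) ^ m) x = (c ^ m) x :=
    swap_mul_pow_apply (fun j h0 hj => ⟨hk j h0 (by omega), fun e => h ⟨j, by simpa using e⟩⟩) m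
      le_rfl
  refine ⟨(m + 1 : ℕ), ?_⟩
  rw [zpow_natCast, pow_succ', Perm.mul_apply, e, Perm.mul_apply, ← Perm.mul_apply c, ← pow_succ',
    hx, swap_apply_left]

theorem sameCycle_setoid_swap_mul [Finite X] {w : Perm X} {a b : X} (h : ¬ SameCycle w a b) :
    SameCycle.setoid (swap a b * w) = joinSetoid (SameCycle.setoid w) a b := by
  have hab : SameCycle (swap a b * w) a b := sameCycle_swap_mul h
  refine le_antisymm (sameCycle_swap_mul_le w a b) (joinSetoid_le ?_ hab)
  have h2 := sameCycle_swap_mul_le (swap a b * w) a b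
  rw [swap_mul_self_mul] at h2
  exact h2.trans (joinSetoid_le le_rfl hab)

theorem numOrbits_swap_mul_add_one [Finite X] {w : Perm X} {a b : X} (h : ¬ SameCycle w a b) :
    numOrbits (swap a b * w) + 1 = numOrbits w := by
  unfold numOrbits
  rw [sameCycle_setoid_swap_mul h, ← card_quotient_joinSetoid _ h]

theorem numOrbits_swap_mul [Finite X] {w : Perm X} {a b : X} (h : SameCycle w a b) (hab : a ≠ b) :
    numOrbits (swap a b * w) = numOrbits w + 1 := by
  have := numOrbits_swap_mul_add_one (not_sameCycle_swap_mul h hab)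
  rw [swap_mul_self_mul] at this
  exact this.symm

theorem numOrbits_swap_mul_le [Finite X] (w : Perm X) (a b : X) :
    numOrbits (swap a b * w) ≤ numOrbits w + 1 := by
  by_cases h : SameCycle w a b
  · by_cases hab : a = b
    · subst hab
      simp [swap_self, ← Perm.one_def]
    · exact (numOrbits_swap_mul h hab).le
  · have := numOrbits_swap_mul_add_one h
    omega

/-- The triangle inequality for the absolute length `|X| - #(w)`. -/
theorem numOrbits_add_le [Finite X] (u v : Perm X) :
    numOrbits u + numOrbits v ≤ Nat.card X + numOrbits (u * v) := by
  induction hm : Nat.card X - numOrbits u using Nat.strong_induction_on generalizing u with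
  | _ m ih =>
    by_cases hu : u = 1
    · rw [hu, numOrbits_one, one_mul]
    · obtain ⟨a, ha⟩ : ∃ a, u a ≠ a := by
        by_contra! h
        exact hu (Perm.ext h)
      -- Splitting `a` off its cycle gains exactly one orbit for `u` and at most one for `u * v`, so
      -- the inequality for the shorter factor gives the one for `u`.
      have h1 := numOrbits_swap_mul (sameCycle_apply_right.mpr (SameCycle.refl u a)) ha.symm
      have h2 := numOrbits_le_card (swap a (u a) * u)
      have h3 := ih _ (by omega) (swap a (u a) * u) rfl
      have h4 := numOrbits_swap_mul_le (u * v) a (u a)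
      rw [mul_assoc] at h3
      omega

end Perm

/-! ### The absolute order: exchange, noncrossing and uniqueness. -/

section AbsoluteOrder

variable {X : Type*}

theorem sameCycle_setoid_inv (w : Perm X) : SameCycle.setoid w⁻¹ = SameCycle.setoid w :=
  Setoid.ext fun _ _ => sameCycle_inv

theorem numOrbits_inv (w : Perm X) : numOrbits w⁻¹ = numOrbits w := by
  unfold numOrbits
  rw [sameCycle_setoid_inv]

/-- The relation `τ ≤ c` in the absolute order of the symmetric group. -/
def AbsLe (τ c : Perm X) : Prop :=
  numOrbits τ + numOrbits (τ⁻¹ * c) = Nat.card X + numOrbits c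

theorem absLe_one [Finite X] (c : Perm X) : AbsLe 1 c := by
  simp [AbsLe, numOrbits_one]

variable [DecidableEq X] {τ τ' c w : Perm X} {a b x y z : X}

theorem inv_mul_swap (w : Perm X) (a b : X) : (w * swap a b)⁻¹ = swap a b * w⁻¹ := by
  rw [mul_inv_rev, swap_inv]

variable [Finite X]

theorem numOrbits_mul_swap_add_one (h : ¬ SameCycle w a b) :
    numOrbits (w * swap a b) + 1 = numOrbits w := by
  rw [← numOrbits_inv, inv_mul_swap, numOrbits_swap_mul_add_one (by rwa [sameCycle_inv]),
    numOrbits_inv]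

theorem numOrbits_mul_swap (h : SameCycle w a b) (hab : a ≠ b) :
    numOrbits (w * swap a b) = numOrbits w + 1 := by
  rw [← numOrbits_inv, inv_mul_swap, numOrbits_swap_mul (by rwa [sameCycle_inv]) hab,
    numOrbits_inv]

theorem sameCycle_setoid_mul_swap (h : ¬ SameCycle w a b) :
    SameCycle.setoid (w * swap a b) = joinSetoid (SameCycle.setoid w) a b := by
  rw [← sameCycle_setoid_inv, inv_mul_swap, sameCycle_setoid_swap_mul (by rwa [sameCycle_inv]),
    sameCycle_setoid_inv]

/-- Moves up in `[1, c]`: cutting the complement gains an orbit, so by the triangle inequality the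
other factor has to lose one. -/
theorem AbsLe.mul_swap (h : AbsLe τ c) (hxy : SameCycle (τ⁻¹ * c) x y) (hne : x ≠ y) :
    ¬ SameCycle τ x y ∧ AbsLe (τ * swap x y) c := by
  have h1 := numOrbits_swap_mul hxy hne
  have h2 := numOrbits_add_le (τ * swap x y) (swap x y * (τ⁻¹ * c))
  have e : τ * swap x y * (swap x y * (τ⁻¹ * c)) = c := by
    rw [mul_assoc, swap_mul_self_mul, mul_inv_cancel_left]
  rw [e] at h2
  unfold AbsLe at h ⊢
  have hn : ¬ SameCycle τ x y := fun t => by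
    have := numOrbits_mul_swap t hne
    omega
  refine ⟨hn, ?_⟩
  have h3 := numOrbits_mul_swap_add_one hn
  rw [inv_mul_swap, mul_assoc]
  omega

/-- Cuts `τ` and `c` simultaneously. The complement does not change, so the triangle inequality
forces `c` to split whenever `τ` does. -/
theorem AbsLe.swap_mul (h : AbsLe τ c) (hxy : SameCycle τ x y) (hne : x ≠ y) :
    SameCycle c x y ∧ AbsLe (swap x y * τ) (swap x y * c) := by
  have h1 := numOrbits_swap_mul hxy hne
  have e : (swap x y * τ)⁻¹ * (swap x y * c) = τ⁻¹ * c := by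
    rw [mul_inv_rev, swap_inv, mul_assoc, swap_mul_self_mul]
  have h2 := numOrbits_add_le (swap x y * τ) ((swap x y * τ)⁻¹ * (swap x y * c))
  rw [mul_inv_cancel_left, e] at h2
  unfold AbsLe at h ⊢
  have hn : SameCycle c x y := by
    by_contra t
    have := numOrbits_swap_mul_add_one t
    omega
  refine ⟨hn, ?_⟩
  have h3 := numOrbits_swap_mul hn hne
  rw [e]
  omega

theorem AbsLe.sameCycle (h : AbsLe τ c) (hxy : SameCycle τ x y) : SameCycle c x y := by
  by_cases hne : x = y
  · exact hne ▸ SameCycle.refl c x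
  · exact (h.swap_mul hxy hne).1

/-- Noncrossing property of `τ ≤ c`: cutting `c` along a pair in one orbit of `τ` does not separate
the elements of another orbit of `τ`. -/
theorem AbsLe.sameCycle_swap_mul_of_not (h : AbsLe τ c) (hxz : SameCycle τ x z)
    (hyw : SameCycle τ y a) (hxy : ¬ SameCycle τ x y) : SameCycle (swap x z * c) y a := by
  by_cases hne : x = z
  · subst hne
    rw [swap_self, ← Perm.one_def, one_mul]
    exact h.sameCycle hyw
  refine (h.swap_mul hxz hne).2.sameCycle ?_
  have h1 := sameCycle_swap_mul_le (swap x z * τ) x z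
  rw [swap_mul_self_mul] at h1
  have h2 : SameCycle.setoid (swap x z * τ) ≤ SameCycle.setoid τ :=
    (sameCycle_swap_mul_le τ x z).trans (joinSetoid_le le_rfl hxz)
  rcases h1 hyw with k | ⟨k | k, -⟩
  · exact k
  · exact absurd (h2 k) hxy
  · exact absurd (hxz.trans (h2 k)) hxy

theorem AbsLe.sameCycle_swap_apply_mul (h : AbsLe τ c) (hx : τ x ≠ x) (hz : SameCycle τ x z)
    (hzx : z ≠ x) : SameCycle (swap x (τ x) * c) (τ x) z := by
  have hxy : SameCycle τ x (τ x) := sameCycle_apply_right.mpr (SameCycle.refl τ x)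
  refine (h.swap_mul hxy hx.symm).2.sameCycle ?_
  have hfix : (swap x (τ x) * τ) x = x := by simp
  have h1 := sameCycle_swap_mul_le (swap x (τ x) * τ) x (τ x)
  rw [swap_mul_self_mul] at h1
  rcases h1 (hxy.symm.trans hz) with k | ⟨-, k | k⟩
  · exact k
  · exact absurd (k.eq_of_left hfix).symm hzx
  · exact k

/-- Along the cycle of `c`, the first later point of the `τ`-orbit of `x` is `τ x`: an earlier `z`
would lie on the arc that cutting at `x` and `τ x` separates from `τ x`, whereas the rest of the
orbit stays with `τ x`. -/
theorem AbsLe.not_first_lt (h : AbsLe τ c) (hx : τ x ≠ x) (hz : SameCycle τ x z) (hzx : z ≠ x)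
    {j k : ℕ} (hk : (c ^ k) x = τ x) (hk' : ∀ i, 0 < i → i < k → (c ^ i) x ≠ τ x)
    (hj : (c ^ j) x = z) : k ≤ j := by
  by_contra! hjk
  have hxy : SameCycle τ x (τ x) := sameCycle_apply_right.mpr (SameCycle.refl τ x)
  refine not_sameCycle_swap_mul (h.sameCycle hxy) hx.symm ?_
  refine SameCycle.trans ?_ (h.sameCycle_swap_apply_mul hx hz hzx).symm
  rw [← hj]
  exact sameCycle_swap_mul_of_first hk hk' hjk

/-- An element of the interval `[1, c]` is determined by its orbits. -/
theorem AbsLe.eq_of_sameCycle (h : AbsLe τ c) (h' : AbsLe τ' c)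
    (e : SameCycle.setoid τ = SameCycle.setoid τ') : τ = τ' := by
  have e' : ∀ {u v}, SameCycle τ u v ↔ SameCycle τ' u v := fun {u v} =>
    iff_of_eq (congrArg (fun r : Setoid X => r u v) e)
  ext x
  have hy : SameCycle τ x (τ x) := sameCycle_apply_right.mpr (SameCycle.refl τ x)
  have hz : SameCycle τ' x (τ' x) := sameCycle_apply_right.mpr (SameCycle.refl τ' x)
  by_cases hx : τ x = x
  · rw [hx]
    exact (e'.mpr hz).eq_of_left hx
  by_cases hx' : τ' x = x
  · exact absurd ((e'.mp hy).eq_of_left hx').symm hx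
  obtain ⟨k, hk0, hk, hk'⟩ := exists_first_pow (h.sameCycle hy)
  obtain ⟨j, hj0, hj, hj'⟩ := exists_first_pow (h'.sameCycle hz)
  have h1 := h.not_first_lt hx (e'.mpr hz) hx' hk hk' hj
  have h2 := h'.not_first_lt hx' (e'.mp hy) hx hj hj' hk
  rw [← hk, ← hj, le_antisymm h1 h2]

end AbsoluteOrder

end AnnularB

/-! ### Negation and signed permutations. -/

namespace SignedSet

variable {n : ℕ}

theorem neg_val (x : SignedSet n) : (-x).1 = -x.1 := rfl

protected theorem neg_neg (x : SignedSet n) : - -x = x := Subtype.ext (neg_neg x.1)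

theorem neg_inj {x y : SignedSet n} : -x = -y ↔ x = y :=
  ⟨fun h => by rw [← SignedSet.neg_neg x, h, SignedSet.neg_neg], fun h => by rw [h]⟩

theorem neg_ne_self (x : SignedSet n) : -x ≠ x := fun h => by
  have h1 : -x.1 = x.1 := congrArg Subtype.val h
  have := x.2.1
  omega

theorem eq_neg_iff {x y : SignedSet n} : x = -y ↔ -x = y := by
  rw [← neg_inj, SignedSet.neg_neg]

end SignedSet

namespace AnnularB

open Equiv Equiv.Perm

section Hyperoctahedral

variable {n : ℕ} {σ τ : Perm (SignedSet n)}

theorem one_mem_hyperoctahedral : (1 : Perm (SignedSet n)) ∈ hyperoctahedral n := fun _ => rfl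

theorem mul_mem_hyperoctahedral (hσ : σ ∈ hyperoctahedral n) (hτ : τ ∈ hyperoctahedral n) :
    σ * τ ∈ hyperoctahedral n := fun x => by
  rw [Perm.mul_apply, hτ x, hσ (τ x), Perm.mul_apply]

theorem inv_mem_hyperoctahedral (hτ : τ ∈ hyperoctahedral n) : τ⁻¹ ∈ hyperoctahedral n := fun x => by
  rw [Perm.inv_eq_iff_eq, hτ, ← Perm.mul_apply, mul_inv_cancel, Perm.one_apply]

theorem pow_mem_hyperoctahedral (hτ : τ ∈ hyperoctahedral n) (k : ℕ) :
    τ ^ k ∈ hyperoctahedral n := by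
  induction k with
  | zero => exact one_mem_hyperoctahedral
  | succ k ih => exact mul_mem_hyperoctahedral ih hτ

theorem zpow_mem_hyperoctahedral (hτ : τ ∈ hyperoctahedral n) (k : ℤ) :
    τ ^ k ∈ hyperoctahedral n := by
  obtain ⟨m, rfl | rfl⟩ := k.eq_nat_or_neg
  · exact pow_mem_hyperoctahedral hτ m
  · rw [zpow_neg]
    exact inv_mem_hyperoctahedral (pow_mem_hyperoctahedral hτ m)

theorem sameCycle_neg_neg (hτ : τ ∈ hyperoctahedral n) {x y : SignedSet n}
    (h : SameCycle τ x y) : SameCycle τ (-x) (-y) := by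
  obtain ⟨k, rfl⟩ := h
  exact ⟨k, zpow_mem_hyperoctahedral hτ k x⟩

theorem inZeroBlock_iff (hτ : τ ∈ hyperoctahedral n) {x : SignedSet n} :
    InZeroBlock τ x ↔ SameCycle τ x (-x) := by
  constructor
  · intro h
    have hx : -x ∈ (fun y => -y) '' {y | τ.SameCycle x y} := ⟨x, SameCycle.refl τ x, rfl⟩
    rw [h] at hx
    exact hx
  · intro h
    ext y
    constructor
    · rintro ⟨z, hz, rfl⟩
      exact h.trans (sameCycle_neg_neg hτ hz)
    · intro hy
      refine ⟨-y, ?_, SignedSet.neg_neg y⟩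
      exact h.trans (sameCycle_neg_neg hτ hy)

theorem omegaTilde_apply (hτ : τ ∈ hyperoctahedral n) {x y : SignedSet n} :
    omegaTilde τ x y ↔ SameCycle τ x y ∨ (SameCycle τ x (-x) ∧ SameCycle τ y (-y)) := by
  rw [← inZeroBlock_iff hτ, ← inZeroBlock_iff hτ]
  rfl

theorem swap_neg_neg_apply (x y z : SignedSet n) : swap (-x) (-y) (-z) = -swap x y z := by
  simp only [swap_apply_def, SignedSet.neg_inj]
  split_ifs <;> rfl

theorem swap_neg_mem_hyperoctahedral (x : SignedSet n) : swap x (-x) ∈ hyperoctahedral n :=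
  fun z => by
    have := swap_neg_neg_apply x (-x) z
    rwa [SignedSet.neg_neg, swap_comm] at this

theorem swap_mul_swap_neg_comm {x y : SignedSet n} (h : x ≠ -y) :
    swap x y * swap (-x) (-y) = swap (-x) (-y) * swap x y := by
  refine (Perm.Disjoint.commute ?_).eq
  intro z
  by_cases hz : z = x ∨ z = y
  · right
    refine swap_apply_of_ne_of_ne ?_ ?_ <;> rintro rfl <;> rcases hz with k | k
    · exact SignedSet.neg_ne_self x k
    · exact h (SignedSet.eq_neg_iff.mpr k)
    · exact h k.symm
    · exact SignedSet.neg_ne_self y k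
  · left
    push Not at hz
    exact swap_apply_of_ne_of_ne hz.1 hz.2

theorem swap_mul_swap_mem_hyperoctahedral {x y : SignedSet n} (h : x ≠ -y) :
    swap x y * swap (-x) (-y) ∈ hyperoctahedral n := by
  intro z
  have h1 := swap_neg_neg_apply (-x) (-y) (swap x y z)
  rw [SignedSet.neg_neg, SignedSet.neg_neg] at h1
  rw [Perm.mul_apply, swap_neg_neg_apply, h1, swap_mul_swap_neg_comm h, Perm.mul_apply]

end Hyperoctahedral

/-! ### The two cycles of `gamma p 1` and coordinates on the long one. -/

section Gamma

variable (p : ℕ)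

/-- The element `p + 1`, which spans the short cycle of `gamma p 1`. -/
def inner : SignedSet (p + 1) := ⟨p + 1, by omega, by push_cast; rw [abs_of_nonneg (by omega)]⟩

/-- The element `1`. -/
def base : SignedSet (p + 1) := ⟨1, one_ne_zero, by push_cast; rw [abs_one]; omega⟩

/-- The element `γ ^ k (1)` of the long cycle of `γ = gamma p 1`. -/
def outer (k : ℤ) : SignedSet (p + 1) := (gamma p 1 ^ k) (base p)

theorem gamma_val (x : SignedSet (p + 1)) : (gamma p 1 x).1 = gammaFun p 1 x.1 := rfl

theorem gamma_mem_hyperoctahedral : gamma p 1 ∈ hyperoctahedral (p + 1) := by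
  rintro ⟨x, h0, h1⟩
  apply Subtype.ext
  have h2 := abs_le.mp h1
  push_cast at h2
  rw [SignedSet.neg_val, gamma_val, gamma_val, SignedSet.neg_val]
  dsimp only
  unfold gammaFun
  push_cast
  split_ifs <;> omega

theorem gamma_inner : gamma p 1 (inner p) = -inner p := by
  apply Subtype.ext
  rw [SignedSet.neg_val, gamma_val]
  dsimp only [inner]
  unfold gammaFun
  push_cast
  split_ifs <;> omega

theorem gamma_neg_inner : gamma p 1 (-inner p) = inner p := by
  rw [gamma_mem_hyperoctahedral, gamma_inner, SignedSet.neg_neg]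

theorem gamma_outer (k : ℤ) : gamma p 1 (outer p k) = outer p (k + 1) := by
  unfold outer
  rw [add_comm k, zpow_add, zpow_one, Perm.mul_apply]

theorem gamma_pow_outer (k : ℤ) (m : ℕ) : (gamma p 1 ^ m) (outer p k) = outer p (k + m) := by
  unfold outer
  rw [add_comm k, zpow_add, zpow_natCast, Perm.mul_apply]

theorem sameCycle_gamma_outer (i j : ℤ) : SameCycle (gamma p 1) (outer p i) (outer p j) :=
  (sameCycle_zpow_left.mpr (SameCycle.refl _ _)).trans (sameCycle_zpow_right.mpr (SameCycle.refl _ _))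

theorem outer_natCast_val {k : ℕ} (hk : k < p) : (outer p k).1 = k + 1 := by
  induction k with
  | zero => rfl
  | succ k ih =>
    push_cast
    rw [← gamma_outer, gamma_val, ih (by omega)]
    unfold gammaFun
    push_cast
    split_ifs <;> omega

variable {p}

theorem outer_self (hp : 1 ≤ p) : outer p p = -outer p 0 := by
  obtain ⟨q, rfl⟩ : ∃ q, p = q + 1 := ⟨p - 1, by omega⟩
  have h1 := outer_natCast_val (q + 1) q.lt_succ_self
  have h0 : (outer (q + 1) 0).1 = 1 := rfl
  apply Subtype.ext
  rw [SignedSet.neg_val, h0]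
  push_cast
  rw [← gamma_outer, gamma_val, h1]
  unfold gammaFun
  push_cast
  split_ifs <;> omega

/-- In the coordinate `outer p`, negation is a shift by `p`; indices therefore count modulo `2 * p`,
and symmetry arguments become integer arithmetic. -/
theorem outer_add (hp : 1 ≤ p) (k : ℤ) : outer p (k + p) = -outer p k := by
  have h : outer p (k + p) = (gamma p 1 ^ k) (outer p p) := by
    unfold outer
    rw [zpow_add, Perm.mul_apply]
  rw [h, outer_self hp, zpow_mem_hyperoctahedral (gamma_mem_hyperoctahedral p)]
  rfl

theorem outer_add_two_mul (hp : 1 ≤ p) (k : ℤ) : outer p (k + 2 * p) = outer p k := by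
  rw [two_mul, ← add_assoc, outer_add hp, outer_add hp, SignedSet.neg_neg]

theorem outer_add_mul (hp : 1 ≤ p) (k m : ℤ) : outer p (k + 2 * p * m) = outer p k := by
  induction m with
  | zero => simp
  | succ m ih => rw [mul_add, mul_one, ← add_assoc, outer_add_two_mul hp, ih]
  | pred m ih => rw [← outer_add_two_mul hp, ← ih]; congr 1; ring

theorem outer_zero_ne (hp : 1 ≤ p) {d : ℤ} (h0 : 0 < d) (h : d < 2 * p) : outer p d ≠ outer p 0 := by
  have e0 : (outer p 0).1 = 1 := rfl
  intro e
  have e1 := congrArg Subtype.val e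
  rw [e0] at e1
  rcases lt_or_ge d p with hd | hd
  · lift d to ℕ using h0.le
    rw [outer_natCast_val p (by omega)] at e1
    omega
  · obtain ⟨m, hm⟩ : ∃ m : ℕ, d = m + p := ⟨(d - p).toNat, by omega⟩
    rw [hm, outer_add hp, SignedSet.neg_val, outer_natCast_val p (by omega)] at e1
    omega

theorem outer_ne (hp : 1 ≤ p) {i j : ℤ} (h0 : i < j) (h : j < i + 2 * p) :
    outer p i ≠ outer p j := by
  intro e
  have e' : (gamma p 1 ^ i) (outer p (j - i)) = (gamma p 1 ^ i) (outer p 0) := by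
    unfold outer at e ⊢
    rw [← Perm.mul_apply, ← Perm.mul_apply, ← zpow_add, ← zpow_add, add_sub_cancel, add_zero, e]
  exact outer_zero_ne hp (by omega) (by omega) ((gamma p 1 ^ i).injective e')

theorem exists_outer_eq (hp : 1 ≤ p) (k i : ℤ) :
    ∃ m, i ≤ m ∧ m < i + 2 * p ∧ outer p k = outer p m := by
  refine ⟨i + (k - i) % (2 * p), ?_, ?_, ?_⟩
  · have := Int.emod_nonneg (k - i) (show (2 * (p : ℤ)) ≠ 0 by omega)
    omega
  · have := Int.emod_lt_of_pos (k - i) (show 0 < 2 * (p : ℤ) by omega)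
    omega
  · rw [← outer_add_mul hp (i + _) ((k - i) / (2 * p)), add_assoc, Int.emod_add_mul_ediv,
      add_sub_cancel]

theorem eq_inner_or_outer (hp : 1 ≤ p) (x : SignedSet (p + 1)) :
    x = inner p ∨ x = -inner p ∨ ∃ k, x = outer p k := by
  obtain ⟨x, h0, h1⟩ := x
  have h2 := abs_le.mp h1
  push_cast at h2
  by_cases h3 : x = p + 1
  · exact Or.inl (Subtype.ext h3)
  by_cases h4 : x = -(p + 1)
  · exact Or.inr (Or.inl (Subtype.ext h4))
  refine Or.inr (Or.inr ?_)
  rcases lt_or_gt_of_ne h0 with h | h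
  · refine ⟨((-x - 1).toNat : ℤ) + p, Subtype.ext ?_⟩
    rw [outer_add hp, SignedSet.neg_val, outer_natCast_val p (by omega)]
    dsimp only
    omega
  · refine ⟨((x - 1).toNat : ℤ), Subtype.ext ?_⟩
    rw [outer_natCast_val p (by omega)]
    dsimp only
    omega

theorem not_sameCycle_gamma (k : ℤ) (hp : 1 ≤ p) :
    ¬ SameCycle (gamma p 1) (outer p k) (inner p) := by
  intro h
  have h1 : SameCycle (gamma p 1) (base p) (inner p) := sameCycle_zpow_left.mp h
  have hle : SameCycle.setoid (gamma p 1) ≤ Setoid.ker (fun x : SignedSet (p + 1) =>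
      (x = inner p ∨ x = -inner p)) := by
    refine sameCycle_setoid_le fun u => ?_
    refine propext ⟨?_, fun hu => ?_⟩
    · rintro (rfl | rfl)
      · exact Or.inr (gamma_inner p)
      · exact Or.inl (gamma_neg_inner p)
    · rcases hu with hu | hu
      · exact Or.inr ((gamma p 1).injective (hu.trans (gamma_neg_inner p).symm))
      · exact Or.inl ((gamma p 1).injective (hu.trans (gamma_inner p).symm))
  have h2 : (base p = inner p ∨ base p = -inner p) := (iff_of_eq (hle h1)).mpr (Or.inl rfl)
  rcases h2 with h2 | h2
  · have : (1 : ℤ) = p + 1 := congrArg Subtype.val h2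
    omega
  · have : (1 : ℤ) = -(p + 1) := congrArg Subtype.val h2
    omega

theorem sameCycle_gamma_neg_inner : SameCycle (gamma p 1) (inner p) (-inner p) :=
  ⟨1, by rw [zpow_one, gamma_inner]⟩

theorem outer_ne_inner (k : ℤ) (hp : 1 ≤ p) : outer p k ≠ inner p := fun h =>
  not_sameCycle_gamma k hp (h ▸ SameCycle.refl _ _)

theorem outer_ne_neg_inner (k : ℤ) (hp : 1 ≤ p) : outer p k ≠ -inner p := fun h =>
  not_sameCycle_gamma k hp (h ▸ sameCycle_gamma_neg_inner.symm)

theorem sameCycle_gamma_cases (hp : 1 ≤ p) (x : SignedSet (p + 1)) :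
    SameCycle (gamma p 1) (outer p 0) x ∨ SameCycle (gamma p 1) (inner p) x := by
  rcases eq_inner_or_outer hp x with rfl | rfl | ⟨k, rfl⟩
  · exact Or.inr (SameCycle.refl _ _)
  · exact Or.inr sameCycle_gamma_neg_inner
  · exact Or.inl (sameCycle_gamma_outer p 0 k)

theorem numOrbits_gamma (hp : 1 ≤ p) : numOrbits (gamma p 1) = 2 :=
  card_quotient_eq_two _ (outer p 0) (inner p) (not_sameCycle_gamma 0 hp)
    (sameCycle_gamma_cases hp)

end Gamma

/-! ### Noncrossing partitions of the long cycle and the interval `[1, γ]`. -/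

section Noncrossing

variable {p : ℕ}

/-- The restriction of `r` to the long cycle of `gamma p 1` is a noncrossing partition. -/
def Noncrossing (p : ℕ) (r : Setoid (SignedSet (p + 1))) : Prop :=
  ∀ ⦃i j k l : ℤ⦄, i < j → j < k → k < l → l < i + 2 * p → r (outer p i) (outer p k) →
    r (outer p j) (outer p l) → r (outer p i) (outer p j)

theorem sameCycle_swap_outer_mul_gamma (hp : 1 ≤ p) {i j k : ℤ} (hij : i ≤ j) (hjk : j < k)
    (hk : k < i + 2 * p) :
    SameCycle (swap (outer p i) (outer p k) * gamma p 1) (outer p i) (outer p j) := by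
  have h := sameCycle_swap_mul_of_first (c := gamma p 1) (x := outer p i) (z := outer p k)
    (k := (k - i).toNat) (j := (j - i).toNat) ?_ ?_ (by omega)
  · rwa [gamma_pow_outer, show i + ((j - i).toNat : ℤ) = j by omega] at h
  · rw [gamma_pow_outer, show i + ((k - i).toNat : ℤ) = k by omega]
  · intro m h0 hm
    rw [gamma_pow_outer]
    exact outer_ne hp (by omega) (by omega)

theorem AbsLe.noncrossing (hp : 1 ≤ p) {τ : Perm (SignedSet (p + 1))} (h : AbsLe τ (gamma p 1)) :
    Noncrossing p (SameCycle.setoid τ) := by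
  intro i j k l hij hjk hkl hl hik hjl
  by_contra hn
  have h1 := h.sameCycle_swap_mul_of_not hik hjl hn
  have h2 := sameCycle_swap_outer_mul_gamma hp hij.le hjk (by omega)
  -- The complementary arc runs from `k` to `i + 2 * p`, which is the point `i` again. An orbit
  -- containing `j` and `l` would connect the two arcs.
  have h3 := sameCycle_swap_outer_mul_gamma hp hkl.le hl (by omega)
  rw [outer_add_two_mul hp, swap_comm] at h3
  exact not_sameCycle_swap_mul (sameCycle_gamma_outer p i k) (outer_ne hp (by omega) (by omega))
    ((h2.trans h1).trans h3.symm)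

theorem neg_outer (hp : 1 ≤ p) (k : ℤ) : -outer p k = outer p (k + p) := (outer_add hp k).symm

/-- `τ` fixes the two points of the short cycle of `gamma p 1`. -/
def FixesInner (τ : Perm (SignedSet (p + 1))) : Prop :=
  τ (inner p) = inner p ∧ τ (-inner p) = -inner p

theorem FixesInner.sameCycle_cases (hp : 1 ≤ p) {τ : Perm (SignedSet (p + 1))} (h : FixesInner τ)
    {x y : SignedSet (p + 1)} (hxy : SameCycle τ x y) :
    x = y ∨ ∃ i j, x = outer p i ∧ y = outer p j := by
  rcases eq_inner_or_outer hp x with rfl | rfl | ⟨i, rfl⟩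
  · exact Or.inl (hxy.eq_of_left h.1)
  · exact Or.inl (hxy.eq_of_left h.2)
  rcases eq_inner_or_outer hp y with rfl | rfl | ⟨j, rfl⟩
  · exact Or.inl (hxy.eq_of_right h.1)
  · exact Or.inl (hxy.eq_of_right h.2)
  · exact Or.inr ⟨i, j, rfl, rfl⟩

theorem FixesInner.exists_inv_outer (hp : 1 ≤ p) {τ : Perm (SignedSet (p + 1))}
    (h : FixesInner τ) (k : ℤ) : ∃ m, τ⁻¹ (outer p k) = outer p m := by
  have hs : SameCycle τ (outer p k) (τ⁻¹ (outer p k)) :=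
    sameCycle_inv.mp (sameCycle_apply_right.mpr (SameCycle.refl _ _))
  rcases h.sameCycle_cases hp hs with e | ⟨i, j, -, e⟩
  · exact ⟨k, e.symm⟩
  · exact ⟨j, e⟩

/-- If the orbits of `τ` are finer than a noncrossing partition `r`, then two orbits of `τ` in one
block of `r` are joined by an orbit of the Kreweras complement `τ⁻¹ γ`. -/
theorem Noncrossing.exists_sameCycle_complement (hp : 1 ≤ p) {r : Setoid (SignedSet (p + 1))}
    (hr : Noncrossing p r) {τ : Perm (SignedSet (p + 1))} (hτ : FixesInner τ)
    (hle : SameCycle.setoid τ ≤ r) {i₀ j₀ : ℤ} (h0 : r (outer p i₀) (outer p j₀))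
    (h0' : ¬ SameCycle τ (outer p i₀) (outer p j₀)) :
    ∃ i j : ℤ, r (outer p i) (outer p j) ∧ ¬ SameCycle τ (outer p i) (outer p j) ∧
      SameCycle (τ⁻¹ * gamma p 1) (outer p i) (outer p j) := by
  -- The pair is chosen with the smallest gap `j - i`; by minimality no index strictly between `i`
  -- and `j` belongs to its block of `r`.
  have hex : ∃ d : ℕ, ∃ i j : ℤ, i < j ∧ j < i + 2 * p ∧ j - i = d ∧ r (outer p i) (outer p j) ∧
      ¬ SameCycle τ (outer p i) (outer p j) := by
    obtain ⟨m, h1, h2, h3⟩ := exists_outer_eq hp j₀ i₀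
    rw [h3] at h0 h0'
    refine ⟨(m - i₀).toNat, i₀, m, lt_of_le_of_ne h1 ?_, h2, by omega, h0, h0'⟩
    rintro rfl
    exact h0' (SameCycle.refl _ _)
  classical
  obtain ⟨i, j, hij, hj, hd, hrij, hn⟩ := Nat.find_spec hex
  have hmin : ∀ i' j' : ℤ, i' < j' → j' < i' + 2 * p → j' - i' < j - i →
      r (outer p i') (outer p j') → SameCycle τ (outer p i') (outer p j') := by
    intro i' j' h1 h2 h3 h4
    by_contra h5
    exact Nat.find_min hex (m := (j' - i').toNat) (by omega) ⟨i', j', h1, h2, by omega, h4, h5⟩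
  have hgap : ∀ k, i < k → k < j → ¬ r (outer p i) (outer p k) := by
    intro k h1 h2 h3
    exact hn ((hmin i k h1 (by omega) (by omega) h3).trans
      (hmin k j h2 (by omega) (by omega) (r.trans (r.symm h3) hrij)))
  obtain ⟨m, hm⟩ := hτ.exists_inv_outer hp j
  have hjm : SameCycle τ (outer p j) (outer p m) := by
    rw [← hm]
    exact sameCycle_inv.mp (sameCycle_apply_right.mpr (SameCycle.refl _ _))
  refine ⟨i, m, r.trans hrij (hle hjm), fun h => hn (h.trans hjm.symm), ?_⟩
  -- The cycle of `i` under `τ⁻¹ γ` must pass through `j - 1`, hence contain `m`. Otherwise each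
  -- step goes from `k` to a point in the block of `k + 1`, which noncrossing confines to the open
  -- gap, and the cycle never returns to `i`.
  by_contra hκ
  have hstep : ∀ k, i ≤ k → k < j → SameCycle (τ⁻¹ * gamma p 1) (outer p i) (outer p k) →
      ∃ k', i < k' ∧ k' < j ∧ (τ⁻¹ * gamma p 1) (outer p k) = outer p k' := by
    intro k h1 h2 h3
    rw [Perm.mul_apply, gamma_outer]
    have hk : k + 1 < j := by
      by_contra h4
      obtain rfl : k + 1 = j := by omega
      refine hκ (h3.trans ?_)
      rw [← hm, ← gamma_outer, ← Perm.mul_apply]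
      exact sameCycle_apply_right.mpr (SameCycle.refl _ _)
    obtain ⟨q', hq'⟩ := hτ.exists_inv_outer hp (k + 1)
    obtain ⟨q, hq1, hq2, hq3⟩ := exists_outer_eq hp q' i
    have hrq : r (outer p (k + 1)) (outer p q) := by
      rw [← hq3, ← hq']
      exact hle (sameCycle_inv.mp (sameCycle_apply_right.mpr (SameCycle.refl _ _)))
    have hg := hgap (k + 1) (by omega) hk
    refine ⟨q, lt_of_le_of_ne hq1 ?_, ?_, hq'.trans hq3⟩
    · rintro rfl
      exact hg (r.symm hrq)
    · by_contra h5
      rcases eq_or_lt_of_le (not_lt.mp h5) with rfl | h6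
      · exact hg (r.trans hrij (r.symm hrq))
      · exact hg (hr (by omega) hk h6 hq2 hrij hrq)
  have hpow : ∀ t : ℕ, ∃ k', i < k' ∧ k' < j ∧
      ((τ⁻¹ * gamma p 1) ^ (t + 1)) (outer p i) = outer p k' := by
    intro t
    induction t with
    | zero => simpa using hstep i le_rfl hij (SameCycle.refl _ _)
    | succ t ih =>
      obtain ⟨k, h1, h2, h3⟩ := ih
      have := hstep k h1.le h2 (by rw [← h3]; exact sameCycle_pow_right.mpr (SameCycle.refl _ _))
      rwa [← h3, ← Perm.mul_apply, ← pow_succ'] at this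
  have ho := orderOf_pos (τ⁻¹ * gamma p 1)
  obtain ⟨k, h1, h2, h3⟩ := hpow (orderOf (τ⁻¹ * gamma p 1) - 1)
  rw [Nat.sub_add_cancel ho, pow_orderOf_eq_one, Perm.one_apply] at h3
  exact outer_ne hp h1 (by omega) h3

theorem numOrbits_conj {X : Type*} (ν w : Perm X) : numOrbits (ν * w * ν⁻¹) = numOrbits w := by
  refine (Nat.card_congr (Quotient.congr ν fun u v => ?_)).symm
  change SameCycle w u v ↔ SameCycle (ν * w * ν⁻¹) (ν u) (ν v)
  simp [sameCycle_conj]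

theorem AbsLe.conj {X : Type*} {τ c : Perm X} (h : AbsLe τ c) (ν : Perm X) :
    AbsLe (ν * τ * ν⁻¹) (ν * c * ν⁻¹) := by
  unfold AbsLe at h ⊢
  rw [numOrbits_conj, numOrbits_conj, ← h, ← numOrbits_conj ν (τ⁻¹ * c)]
  congr 2
  group

/-- Negation, as a permutation. -/
def negPerm (n : ℕ) : Perm (SignedSet n) :=
  ⟨fun x => -x, fun x => -x, SignedSet.neg_neg, SignedSet.neg_neg⟩

theorem negPerm_conj {n : ℕ} {τ : Perm (SignedSet n)} :
    negPerm n * τ * (negPerm n)⁻¹ = τ ↔ τ ∈ hyperoctahedral n := by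
  rw [mul_inv_eq_iff_eq_mul]
  constructor
  · intro h x
    exact (congrArg (fun σ : Perm (SignedSet n) => σ x) h).symm
  · intro h
    ext1 x
    exact (h x).symm

/-- Conjugation by negation preserves `c` and the orbits of `τ`, and an element of `[1, c]` is
determined by its orbits. -/
theorem AbsLe.mem_hyperoctahedral {n : ℕ} {τ c : Perm (SignedSet n)} (h : AbsLe τ c)
    (hc : c ∈ hyperoctahedral n) (hs : ∀ x y, SameCycle τ x y → SameCycle τ (-x) (-y)) :
    τ ∈ hyperoctahedral n := by
  refine negPerm_conj.mp ?_
  have h1 := h.conj (negPerm n)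
  rw [negPerm_conj.mpr hc] at h1
  refine h1.eq_of_sameCycle h (Setoid.ext fun x y => ?_)
  change SameCycle _ x y ↔ SameCycle τ x y
  rw [sameCycle_conj]
  change SameCycle τ (-x) (-y) ↔ _
  refine ⟨fun k => ?_, hs x y⟩
  have := hs _ _ k
  rwa [SignedSet.neg_neg, SignedSet.neg_neg] at this

/-- Every symmetric noncrossing partition of the long cycle is the orbit partition of an element of
the interval `[1, γ]`. -/
theorem Noncrossing.exists_absLe (hp : 1 ≤ p) {r : Setoid (SignedSet (p + 1))}
    (hr : Noncrossing p r) (hs : ∀ x y, r x y → r (-x) (-y)) :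
    ∃ τ : Perm (SignedSet (p + 1)), AbsLe τ (gamma p 1) ∧ τ ∈ hyperoctahedral (p + 1) ∧
      FixesInner τ ∧ ∀ i j, SameCycle τ (outer p i) (outer p j) ↔ r (outer p i) (outer p j) := by
  -- Among the elements of `[1, γ]` with orbits finer than `r`, one with the fewest orbits is taken.
  -- If it failed to fill a block, a complement cycle would supply a transposition merging two of
  -- its orbits inside that block.
  obtain ⟨τ, ⟨h1, h2, h3⟩, hmin⟩ := (measure (numOrbits (X := SignedSet (p + 1)))).wf.has_min
    {τ | AbsLe τ (gamma p 1) ∧ FixesInner τ ∧ SameCycle.setoid τ ≤ r}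
    ⟨1, absLe_one _, ⟨rfl, rfl⟩, fun x y h => by rw [sameCycle_one.mp h]⟩
  have h4 : ∀ i j, SameCycle τ (outer p i) (outer p j) ↔ r (outer p i) (outer p j) := by
    refine fun i j => ⟨fun h => h3 h, fun h => ?_⟩
    by_contra hn
    obtain ⟨k, l, hkl, hkl', hκ⟩ := hr.exists_sameCycle_complement hp h2 h3 h hn
    have hne : outer p k ≠ outer p l := fun e => hkl' (e ▸ SameCycle.refl _ _)
    refine hmin (τ * swap (outer p k) (outer p l)) ⟨(h1.mul_swap hκ hne).2, ⟨?_, ?_⟩, ?_⟩ ?_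
    · rw [Perm.mul_apply, swap_apply_of_ne_of_ne (outer_ne_inner k hp).symm
        (outer_ne_inner l hp).symm, h2.1]
    · rw [Perm.mul_apply, swap_apply_of_ne_of_ne (outer_ne_neg_inner k hp).symm
        (outer_ne_neg_inner l hp).symm, h2.2]
    · rw [sameCycle_setoid_mul_swap hkl']
      exact joinSetoid_le h3 hkl
    · have := numOrbits_mul_swap_add_one hkl'
      change numOrbits _ < numOrbits _
      omega
  refine ⟨τ, h1, h1.mem_hyperoctahedral (gamma_mem_hyperoctahedral p) fun x y h => ?_, h2, h4⟩
  rcases h2.sameCycle_cases hp h with rfl | ⟨i, j, rfl, rfl⟩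
  · exact SameCycle.refl _ _
  · have := hs _ _ (h3 h)
    rw [neg_outer hp, neg_outer hp] at this ⊢
    exact (h4 _ _).mpr this

end Noncrossing

/-! ### Orbits of the group generated by two permutations. -/

section JointOrbits

variable {X : Type*} {τ c : Perm X}

/-- The partition into orbits of the group generated by `τ` and `c`. -/
abbrev jointSetoid (τ c : Perm X) : Setoid X :=
  MulAction.orbitRel (Subgroup.closure {τ, c}) X

theorem sameCycle_setoid_le_jointSetoid {g : Perm X} (hg : g ∈ ({τ, c} : Set (Perm X))) :
    SameCycle.setoid g ≤ jointSetoid τ c :=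
  sameCycle_setoid_le fun _ => (jointSetoid τ c).symm
    (⟨⟨g, Subgroup.subset_closure hg⟩, rfl⟩ : (jointSetoid τ c) _ _)

theorem jointSetoid_le {r : Setoid X} (hτ : ∀ u, r u (τ u)) (hc : ∀ u, r u (c u)) :
    jointSetoid τ c ≤ r := by
  have key : ∀ g ∈ Subgroup.closure {τ, c}, ∀ u, r u (g u) := by
    intro g hg
    induction hg using Subgroup.closure_induction with
    | mem g hg =>
      rcases hg with rfl | rfl
      · exact hτ
      · exact hc
    | one => exact fun u => r.refl u
    | mul g h _ _ ihg ihh => exact fun u => r.trans (ihh u) (ihg (h u))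
    | inv g _ ih =>
      intro u
      have := ih (g⁻¹ u)
      rw [← Perm.mul_apply, mul_inv_cancel, Perm.one_apply] at this
      exact r.symm this
  rintro u v ⟨⟨g, hg⟩, rfl⟩
  exact r.symm (key g hg v)

theorem numJointOrbits_eq_of_forall_sameCycle (h : ∀ u, SameCycle c u (τ u)) :
    numJointOrbits τ c = numOrbits c := by
  have e : jointSetoid τ c = SameCycle.setoid c :=
    le_antisymm (jointSetoid_le h fun u => sameCycle_apply_right.mpr (SameCycle.refl c u))
      (sameCycle_setoid_le_jointSetoid (Or.inr rfl))
  exact congrArg (fun r : Setoid X => Nat.card (Quotient r)) e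

theorem AbsLe.forall_sameCycle [DecidableEq X] [Finite X] (h : AbsLe τ c) (u : X) :
    SameCycle c u (τ u) := h.sameCycle (sameCycle_apply_right.mpr (SameCycle.refl τ u))

theorem AbsLe.mem_ncPerms [DecidableEq X] [Finite X] (h : AbsLe τ c) : τ ∈ ncPerms c := by
  have h1 := numJointOrbits_eq_of_forall_sameCycle h.forall_sameCycle
  unfold AbsLe at h
  unfold ncPerms
  change _ = _
  omega

end JointOrbits

/-! ### Multiplication by a pair of opposite transpositions. -/

section DoubleSwap

variable {n : ℕ} {τ c κ : Perm (SignedSet n)} {x y b : SignedSet n}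

/-- If the complement cycle were not symmetric, the cuts at `x, y` and at `-x, -y` would be
independent, and both transpositions could be absorbed into `τ`. But after the first one, `-x` and
`-y` are already in one orbit, through `x ~ -y` and its negative. -/
theorem AbsLe.sameCycle_complement_neg (h : AbsLe τ c) (hc : c ∈ hyperoctahedral n)
    (hτ : τ ∈ hyperoctahedral n) (hxy : SameCycle (τ⁻¹ * c) x y) (hne : x ≠ y)
    (hn : SameCycle τ x (-y)) : SameCycle (τ⁻¹ * c) x (-x) := by
  by_contra hx
  have hκ := mul_mem_hyperoctahedral (inv_mem_hyperoctahedral hτ) hc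
  obtain ⟨h1, h2⟩ := h.mul_swap hxy hne
  have e : (τ * swap x y)⁻¹ * c = swap x y * (τ⁻¹ * c) := by rw [inv_mul_swap, mul_assoc]
  have hle : SameCycle.setoid (swap x y * (τ⁻¹ * c)) ≤ SameCycle.setoid (τ⁻¹ * c) :=
    (sameCycle_swap_mul_le _ x y).trans (joinSetoid_le le_rfl hxy)
  have h3 : SameCycle ((τ * swap x y)⁻¹ * c) (-x) (-y) := by
    rw [e]
    have h4 := sameCycle_swap_mul_le (swap x y * (τ⁻¹ * c)) x y
    rw [swap_mul_self_mul] at h4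
    rcases h4 (sameCycle_neg_neg hκ hxy) with k | ⟨k | k, -⟩
    · exact k
    · exact absurd (hle k) hx
    · exact absurd (hxy.trans (hle k)) hx
  refine (h2.mul_swap h3 fun t => hne (SignedSet.neg_inj.mp t)).1 ?_
  change SameCycle.setoid (τ * swap x y) (-x) (-y)
  rw [sameCycle_setoid_mul_swap h1]
  have hn' := sameCycle_neg_neg hτ hn
  rw [SignedSet.neg_neg] at hn'
  exact Or.inr ⟨Or.inr hn'.symm, Or.inl hn⟩

theorem not_sameCycle_of_fixed {X : Type*} {τ : Perm X} {x b : X} (hb : τ b = b) (hx : x ≠ b) :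
    ¬ SameCycle τ x b := fun h => hx (h.eq_of_right hb)

theorem not_sameCycle_mul_swap_neg (hb : τ b = b) (hb' : τ (-b) = -b) (hx : x ≠ b) (hx' : x ≠ -b) :
    ¬ SameCycle (τ * swap x b) (-x) (-b) := by
  change ¬ SameCycle.setoid (τ * swap x b) (-x) (-b)
  rw [sameCycle_setoid_mul_swap (not_sameCycle_of_fixed hb hx)]
  rintro (k | ⟨-, k | k⟩)
  · exact hx (SignedSet.neg_inj.mp (SameCycle.eq_of_right k hb'))
  · exact hx' (SameCycle.eq_of_right k hb')
  · exact SignedSet.neg_ne_self b (SameCycle.eq_of_right k hb').symm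

theorem sameCycle_setoid_mul_swap_mul_swap (hb : τ b = b) (hb' : τ (-b) = -b) (hx : x ≠ b)
    (hx' : x ≠ -b) : SameCycle.setoid (τ * (swap x b * swap (-x) (-b))) =
      joinSetoid (joinSetoid (SameCycle.setoid τ) x b) (-x) (-b) := by
  rw [← mul_assoc, sameCycle_setoid_mul_swap (not_sameCycle_mul_swap_neg hb hb' hx hx'),
    sameCycle_setoid_mul_swap (not_sameCycle_of_fixed hb hx)]

theorem numOrbits_mul_swap_mul_swap (hb : τ b = b) (hb' : τ (-b) = -b) (hx : x ≠ b)
    (hx' : x ≠ -b) : numOrbits (τ * (swap x b * swap (-x) (-b))) + 2 = numOrbits τ := by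
  have h1 := numOrbits_mul_swap_add_one (not_sameCycle_mul_swap_neg hb hb' hx hx')
  have h2 := numOrbits_mul_swap_add_one (not_sameCycle_of_fixed (x := x) hb hx)
  rw [← mul_assoc]
  omega

theorem eq_or_eq_neg_of_sameCycle (hb : κ b = -b) (hb' : κ (-b) = b) {u : SignedSet n}
    (h : SameCycle κ b u) : u = b ∨ u = -b := by
  have hle : SameCycle.setoid κ ≤ Setoid.ker (fun x : SignedSet n => (x = b ∨ x = -b)) := by
    refine sameCycle_setoid_le fun u => ?_
    refine propext ⟨?_, fun hu => ?_⟩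
    · rintro (rfl | rfl)
      · exact Or.inr hb
      · exact Or.inl hb'
    · rcases hu with hu | hu
      · exact Or.inr (κ.injective (hu.trans hb'.symm))
      · exact Or.inl (κ.injective (hu.trans hb.symm))
  exact (iff_of_eq (hle h)).mp (Or.inl rfl)

theorem sameCycle_self_neg_of_apply (hb : κ b = -b) : SameCycle κ b (-b) := by
  rw [← hb]
  exact sameCycle_apply_right.mpr (SameCycle.refl _ _)

theorem not_sameCycle_of_two_cycle (hb : κ b = -b) (hb' : κ (-b) = b) (hx : x ≠ b)
    (hx' : x ≠ -b) : ¬ SameCycle κ x b := fun h =>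
  (eq_or_eq_neg_of_sameCycle hb hb' h.symm).elim hx hx'

/-- The first transposition merges the 2-cycle `{b, -b}` into the cycle of `x`. Whether the second
one then splits or merges depends on whether the cycle of `x` was symmetric; the two lemmas below
record the net change in orbits, `0` or `-2`. -/
theorem sameCycle_swap_mul_neg_iff (hb : κ b = -b) (hb' : κ (-b) = b) (hx : x ≠ b)
    (hx' : x ≠ -b) : SameCycle (swap x b * κ) (-x) (-b) ↔ SameCycle κ x (-x) := by
  have hn : ¬ SameCycle κ b (-x) := fun h =>
    (eq_or_eq_neg_of_sameCycle hb hb' h).elim (fun e => hx' (SignedSet.eq_neg_iff.mpr e))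
      fun e => hx (SignedSet.neg_inj.mp e)
  change SameCycle.setoid (swap x b * κ) (-x) (-b) ↔ _
  rw [sameCycle_setoid_swap_mul (not_sameCycle_of_two_cycle hb hb' hx hx')]
  constructor
  · rintro (k | ⟨k | k, -⟩)
    · exact absurd ((sameCycle_self_neg_of_apply hb).trans (SameCycle.symm k)) hn
    · exact k
    · exact absurd k hn
  · exact fun k => Or.inr ⟨Or.inl k, Or.inr (sameCycle_self_neg_of_apply hb)⟩

theorem numOrbits_swap_mul_swap_mul_of_sameCycle (hb : κ b = -b) (hb' : κ (-b) = b) (hx : x ≠ b)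
    (hx' : x ≠ -b) (h : SameCycle κ x (-x)) :
    numOrbits (swap (-x) (-b) * swap x b * κ) = numOrbits κ := by
  have h1 := numOrbits_swap_mul_add_one (not_sameCycle_of_two_cycle hb hb' hx hx')
  have h2 := numOrbits_swap_mul ((sameCycle_swap_mul_neg_iff hb hb' hx hx').mpr h)
    fun e => hx (SignedSet.neg_inj.mp e)
  rw [mul_assoc]
  omega

theorem numOrbits_swap_mul_swap_mul_of_not_sameCycle (hb : κ b = -b) (hb' : κ (-b) = b)
    (hx : x ≠ b) (hx' : x ≠ -b) (h : ¬ SameCycle κ x (-x)) :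
    numOrbits (swap (-x) (-b) * swap x b * κ) + 2 = numOrbits κ := by
  have h1 := numOrbits_swap_mul_add_one (not_sameCycle_of_two_cycle hb hb' hx hx')
  have h2 := numOrbits_swap_mul_add_one
    fun t => h ((sameCycle_swap_mul_neg_iff hb hb' hx hx').mp t)
  rw [mul_assoc]
  omega

theorem mul_swap_mul_swap_inv_mul (τ c : Perm (SignedSet n)) (x b : SignedSet n) :
    (τ * (swap x b * swap (-x) (-b)))⁻¹ * c = swap (-x) (-b) * swap x b * (τ⁻¹ * c) := by
  simp only [mul_inv_rev, swap_inv, mul_assoc]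

end DoubleSwap

/-! ### Classification of the annular noncrossing permutations. -/

section Classification

variable {p : ℕ} {τ : Perm (SignedSet (p + 1))}

theorem FixesInner.complement_inner (h : FixesInner τ) :
    (τ⁻¹ * gamma p 1) (inner p) = -inner p ∧ (τ⁻¹ * gamma p 1) (-inner p) = inner p := by
  constructor
  · rw [Perm.mul_apply, gamma_inner, Perm.inv_eq_iff_eq, h.2]
  · rw [Perm.mul_apply, gamma_neg_inner, Perm.inv_eq_iff_eq, h.1]

/-- The permutation obtained from `τ` by inserting `inner p` after `outer p i` and `-inner p`
after `-outer p i`. -/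
def attachInner (τ : Perm (SignedSet (p + 1))) (i : ℤ) : Perm (SignedSet (p + 1)) :=
  τ * (swap (outer p i) (inner p) * swap (-outer p i) (-inner p))

theorem sameCycle_setoid_attachInner (hp : 1 ≤ p) (hτ : FixesInner τ) (i : ℤ) :
    SameCycle.setoid (attachInner τ i) =
      joinSetoid (joinSetoid (SameCycle.setoid τ) (outer p i) (inner p)) (-outer p i) (-inner p) :=
  sameCycle_setoid_mul_swap_mul_swap hτ.1 hτ.2 (outer_ne_inner i hp) (outer_ne_neg_inner i hp)

/-- `τ` loses two orbits, the complement keeps its number because the cycle at `outer p i` is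
symmetric, and the joint orbits drop from two to one: both sides of the genus equation fall by two.
-/
theorem attachInner_mem_ncPermsB (hp : 1 ≤ p) (h : AbsLe τ (gamma p 1))
    (hτ : τ ∈ hyperoctahedral (p + 1)) (hf : FixesInner τ) {i : ℤ}
    (hi : SameCycle (τ⁻¹ * gamma p 1) (outer p i) (-outer p i)) :
    attachInner τ i ∈ ncPermsB p 1 := by
  have hx := outer_ne_inner i hp
  have hx' := outer_ne_neg_inner i hp
  refine ⟨?_, mul_mem_hyperoctahedral hτ (swap_mul_swap_mem_hyperoctahedral hx')⟩
  have h1 := numOrbits_mul_swap_mul_swap hf.1 hf.2 hx hx'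
  have h2 := numOrbits_swap_mul_swap_mul_of_sameCycle hf.complement_inner.1 hf.complement_inner.2
    hx hx' hi
  rw [← mul_swap_mul_swap_inv_mul] at h2
  have hJ : numJointOrbits (attachInner τ i) (gamma p 1) = 1 := by
    refine card_quotient_eq_one _ (inner p) fun u => ?_
    have hs : SameCycle (attachInner τ i) (inner p) (outer p i) := by
      change SameCycle.setoid (attachInner τ i) (inner p) (outer p i)
      rw [sameCycle_setoid_attachInner hp hf]
      exact Or.inl ((joinSetoid _ _ _).symm (joinSetoid_rel _ _ _))
    have hs' := sameCycle_setoid_le_jointSetoid (c := gamma p 1) (Or.inl rfl) hs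
    have hγ := sameCycle_setoid_le_jointSetoid (τ := attachInner τ i) (c := gamma p 1) (Or.inr rfl)
    rcases sameCycle_gamma_cases hp u with k | k
    · exact (jointSetoid _ _).trans hs' (hγ ((sameCycle_gamma_outer p i 0).trans k))
    · exact hγ k
  have h3 := numOrbits_gamma hp
  unfold AbsLe at h
  change numOrbits (attachInner τ i) + numOrbits ((attachInner τ i)⁻¹ * gamma p 1) +
    numOrbits (gamma p 1) = Nat.card (SignedSet (p + 1)) + 2 * numJointOrbits _ _
  unfold attachInner at hJ ⊢
  omega

/-- The annular noncrossing permutations of type `B` are the symmetric elements of `[1, γ]`,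
and the permutations obtained from these by attaching the short cycle of `γ` at an element of an
inversion-invariant orbit of the complement. -/
theorem absLe_or_exists_attachInner (hp : 1 ≤ p) (h : τ ∈ ncPermsB p 1) :
    AbsLe τ (gamma p 1) ∨ ∃ σ i, AbsLe σ (gamma p 1) ∧ σ ∈ hyperoctahedral (p + 1) ∧ FixesInner σ ∧
      SameCycle (σ⁻¹ * gamma p 1) (outer p i) (-outer p i) ∧ τ = attachInner σ i := by
  obtain ⟨hnc, hτ⟩ := h
  change _ = _ at hnc
  have h3 := numOrbits_gamma hp
  by_cases hin : τ (inner p) = inner p ∨ τ (inner p) = -inner p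
  · left
    have hpre : ∀ u, τ u = inner p ∨ τ u = -inner p → u = inner p ∨ u = -inner p := by
      intro u hu
      by_contra! hne
      rcases hin with e | e <;> rcases hu with e' | e'
      · exact hne.1 (τ.injective (e'.trans e.symm))
      · rw [← e, ← hτ] at e'
        exact hne.2 (τ.injective e')
      · rw [SignedSet.eq_neg_iff, ← hτ] at e
        exact hne.2 (τ.injective (e'.trans e.symm))
      · exact hne.1 (τ.injective (e'.trans e.symm))
    have hJ := numJointOrbits_eq_of_forall_sameCycle (τ := τ) (c := gamma p 1) fun u => by
      rcases eq_inner_or_outer hp u with rfl | rfl | ⟨k, rfl⟩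
      · rcases hin with e | e <;> rw [e]
        exact sameCycle_gamma_neg_inner
      · rcases hin with e | e <;> rw [hτ, e]
        rw [SignedSet.neg_neg]
        exact sameCycle_gamma_neg_inner.symm
      · rcases eq_inner_or_outer hp (τ (outer p k)) with e | e | ⟨l, e⟩
        · exact absurd (hpre _ (Or.inl e)) (by simp [outer_ne_inner k hp, outer_ne_neg_inner k hp])
        · exact absurd (hpre _ (Or.inr e)) (by simp [outer_ne_inner k hp, outer_ne_neg_inner k hp])
        · rw [e]
          exact sameCycle_gamma_outer p k l
    unfold AbsLe
    omega
  · right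
    push Not at hin
    obtain ⟨m, hm⟩ : ∃ m, τ (inner p) = outer p m := by
      rcases eq_inner_or_outer hp (τ (inner p)) with e | e | e
      · exact absurd e hin.1
      · exact absurd e hin.2
      · exact e
    obtain ⟨i, hi⟩ : ∃ i, τ (outer p i) = inner p := by
      rcases eq_inner_or_outer hp (τ⁻¹ (inner p)) with e | e | ⟨i, e⟩ <;>
        rw [Perm.inv_eq_iff_eq] at e
      · exact absurd e.symm hin.1
      · rw [hτ, SignedSet.eq_neg_iff] at e
        exact absurd e.symm hin.2
      · exact ⟨i, e.symm⟩
    have hx := outer_ne_inner i hp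
    have hx' := outer_ne_neg_inner i hp
    have hJ : numJointOrbits τ (gamma p 1) = 1 := by
      refine card_quotient_eq_one _ (inner p) fun u => ?_
      have hs : SameCycle τ (inner p) (outer p m) := by
        rw [← hm]
        exact sameCycle_apply_right.mpr (SameCycle.refl _ _)
      have hs' := sameCycle_setoid_le_jointSetoid (c := gamma p 1) (Or.inl rfl) hs
      have hγ := sameCycle_setoid_le_jointSetoid (τ := τ) (c := gamma p 1) (Or.inr rfl)
      rcases sameCycle_gamma_cases hp u with k | k
      · exact (jointSetoid _ _).trans hs' (hγ ((sameCycle_gamma_outer p m 0).trans k))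
      · exact hγ k
    -- The product of the two disjoint transpositions is an involution, so the operation that
    -- attaches `±inner p` also detaches them.
    have hσ : attachInner τ i ∈ hyperoctahedral (p + 1) :=
      mul_mem_hyperoctahedral hτ (swap_mul_swap_mem_hyperoctahedral hx')
    have hf1 : attachInner τ i (inner p) = inner p := by
      unfold attachInner
      rw [Perm.mul_apply, Perm.mul_apply, swap_apply_of_ne_of_ne (a := -outer p i)
        (fun e => hx' (SignedSet.eq_neg_iff.mpr e.symm)) (SignedSet.neg_ne_self _).symm,
        swap_apply_right, hi]
    have hf : FixesInner (attachInner τ i) := ⟨hf1, by rw [hσ, hf1]⟩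
    have hτσ : τ = attachInner (attachInner τ i) i := by
      unfold attachInner
      nth_rewrite 2 [swap_mul_swap_neg_comm hx']
      rw [mul_assoc, mul_assoc (swap _ _), swap_mul_self_mul, swap_mul_self, mul_one]
    generalize attachInner τ i = σ at *
    have h1 := numOrbits_mul_swap_mul_swap hf.1 hf.2 hx hx'
    have h4 := numOrbits_add_le σ (σ⁻¹ * gamma p 1)
    rw [mul_inv_cancel_left] at h4
    have hκ := mul_swap_mul_swap_inv_mul σ (gamma p 1) (outer p i) (inner p)
    change _ + _ = _ at h1
    change numOrbits (attachInner σ i) + 2 = _ at h1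
    change (attachInner σ i)⁻¹ * _ = _ at hκ
    rw [← hτσ] at h1 hκ
    -- Were this cycle not symmetric, the complement of `σ` would have two orbits more than that of
    -- `τ`, and `σ` would violate the triangle inequality.
    have hsc : SameCycle (σ⁻¹ * gamma p 1) (outer p i) (-outer p i) := by
      by_contra hn
      have h2 := numOrbits_swap_mul_swap_mul_of_not_sameCycle hf.complement_inner.1
        hf.complement_inner.2 hx hx' hn
      rw [← hκ] at h2
      omega
    have h2 := numOrbits_swap_mul_swap_mul_of_sameCycle hf.complement_inner.1
      hf.complement_inner.2 hx hx' hsc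
    rw [← hκ] at h2
    refine ⟨σ, i, ?_, hσ, hf, hsc, hτσ⟩
    unfold AbsLe
    omega

end Classification

/-! ### The intrinsic description of the partitions. -/

section Admissible

variable {p : ℕ}

/-- Intrinsic description of the partitions in `NCB p 1`: they are symmetric, have at most one zero
block, and they restrict to a noncrossing partition of the long cycle, both before and after the
blocks of the two elements of the short cycle are merged. -/
structure IsAdmissible (p : ℕ) (π : Setoid (SignedSet (p + 1))) : Prop where
  neg : ∀ ⦃x y⦄, π x y → π (-x) (-y)
  zero : ∀ ⦃x y⦄, π x (-x) → π y (-y) → π x y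
  noncrossing : Noncrossing p π
  noncrossing_join : Noncrossing p (joinSetoid π (inner p) (-inner p))

theorem Noncrossing.congr {r s : Setoid (SignedSet (p + 1))} (hr : Noncrossing p r)
    (h : ∀ i j, s (outer p i) (outer p j) ↔ r (outer p i) (outer p j)) : Noncrossing p s := by
  intro i j k l h1 h2 h3 h4 h5 h6
  exact (h _ _).mpr (hr h1 h2 h3 h4 ((h _ _).mp h5) ((h _ _).mp h6))

/-- Two distinct symmetric blocks would cross, as diameters of a circle do. Hence merging
zero-blocks does not change the trace of a noncrossing partition on the long cycle. -/
theorem Noncrossing.rel_of_zero (hp : 1 ≤ p) {r : Setoid (SignedSet (p + 1))}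
    (hr : Noncrossing p r) {i j : ℤ} (hi : r (outer p i) (-outer p i))
    (hj : r (outer p j) (-outer p j)) : r (outer p i) (outer p j) := by
  have key : ∀ m : ℤ, i ≤ m → m < i + p → r (outer p m) (-outer p m) →
      r (outer p i) (outer p m) := by
    intro m h1 h2 hm
    rcases eq_or_lt_of_le h1 with rfl | h1
    · exact r.refl _
    · rw [neg_outer hp] at hi hm
      exact hr h1 h2 (by omega : i + p < m + p) (by omega) hi hm
  obtain ⟨m, h1, h2, h3⟩ := exists_outer_eq hp j i
  rw [h3] at hj ⊢
  rcases lt_or_ge m (i + p) with h4 | h4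
  · exact key m h1 h4 hj
  · have e : outer p m = -outer p (m - p) := by rw [← outer_add hp, sub_add_cancel]
    rw [e, SignedSet.neg_neg] at hj
    rw [e]
    exact r.trans (key (m - p) (by omega) (by omega) (r.symm hj)) (r.symm hj)

theorem omegaTilde_neg {n : ℕ} {τ : Perm (SignedSet n)} (hτ : τ ∈ hyperoctahedral n)
    {x y : SignedSet n} (h : omegaTilde τ x y) : omegaTilde τ (-x) (-y) := by
  rw [omegaTilde_apply hτ] at h ⊢
  exact h.imp (sameCycle_neg_neg hτ)
    fun h => ⟨sameCycle_neg_neg hτ h.1, sameCycle_neg_neg hτ h.2⟩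

theorem omegaTilde_zero {n : ℕ} {τ : Perm (SignedSet n)} (hτ : τ ∈ hyperoctahedral n)
    {x y : SignedSet n} (hx : omegaTilde τ x (-x)) (hy : omegaTilde τ y (-y)) :
    omegaTilde τ x y := by
  rw [omegaTilde_apply hτ] at hx hy ⊢
  exact Or.inr ⟨hx.elim id And.left, hy.elim id And.left⟩

theorem AbsLe.not_sameCycle_inner (hp : 1 ≤ p) {τ : Perm (SignedSet (p + 1))}
    (h : AbsLe τ (gamma p 1)) (k : ℤ) : ¬ SameCycle τ (inner p) (outer p k) := fun t =>
  not_sameCycle_gamma k hp (h.sameCycle t).symm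

theorem AbsLe.not_sameCycle_neg_inner (hp : 1 ≤ p) {τ : Perm (SignedSet (p + 1))}
    (h : AbsLe τ (gamma p 1)) (k : ℤ) : ¬ SameCycle τ (-inner p) (outer p k) := fun t =>
  not_sameCycle_gamma k hp ((h.sameCycle t).symm.trans sameCycle_gamma_neg_inner.symm)

/-- No orbit meets both cycles of `γ`. If `inner p` is in a zero-block, merging does nothing;
otherwise its block contains no point of the long cycle. -/
theorem AbsLe.isAdmissible (hp : 1 ≤ p) {τ : Perm (SignedSet (p + 1))}
    (h : AbsLe τ (gamma p 1)) (hτ : τ ∈ hyperoctahedral (p + 1)) :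
    IsAdmissible p (omegaTilde τ) := by
  have hnc : Noncrossing p (omegaTilde τ) := by
    refine (h.noncrossing hp).congr fun i j => ?_
    rw [omegaTilde_apply hτ]
    exact ⟨fun t => t.elim id fun t => (h.noncrossing hp).rel_of_zero hp t.1 t.2, Or.inl⟩
  refine ⟨fun x y => omegaTilde_neg hτ, fun x y => omegaTilde_zero hτ, hnc,
    hnc.congr fun i j => ⟨fun t => ?_, fun t => Or.inl t⟩⟩
  by_cases hz : SameCycle τ (inner p) (-inner p)
  · exact joinSetoid_le le_rfl (Or.inl hz : omegaTilde τ _ _) t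
  · rcases t with t | ⟨t | t, -⟩
    · exact t
    · rw [omegaTilde_apply hτ] at t
      exact absurd t (by simp [hz, h.not_sameCycle_inner hp])
    · rw [omegaTilde_apply hτ, SignedSet.neg_neg, sameCycle_comm (x := -inner p)] at t
      have := h.not_sameCycle_neg_inner hp i
      rw [sameCycle_comm] at this
      exact absurd t (by simp [this, sameCycle_comm (x := -inner p), hz])

section Attach

variable {σ : Perm (SignedSet (p + 1))} {i : ℤ}

theorem sameCycle_attachInner_iff (hp : 1 ≤ p) (hf : FixesInner σ) {u v : SignedSet (p + 1)} :
    SameCycle (attachInner σ i) u v ↔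
      joinSetoid (joinSetoid (SameCycle.setoid σ) (outer p i) (inner p))
        (-outer p i) (-inner p) u v := by
  rw [← sameCycle_setoid_attachInner hp hf]
  rfl

theorem setoid_apply {X : Type*} {σ : Perm X} {u v : X} :
    SameCycle.setoid σ u v ↔ SameCycle σ u v := Iff.rfl

theorem FixesInner.not_sameCycle_inner_neg (hf : FixesInner σ) :
    ¬ SameCycle σ (inner p) (-inner p) := fun h =>
  SignedSet.neg_ne_self _ (h.eq_of_left hf.1).symm

/-- The orbits of `outer p i` and its negative are distinct, so each receives just one of `±inner p`
and no two orbits on the long cycle are merged. -/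
theorem sameCycle_attachInner_outer (hp : 1 ≤ p) (h : AbsLe σ (gamma p 1)) (hf : FixesInner σ)
    (hn : ¬ SameCycle σ (outer p i) (-outer p i)) (j k : ℤ) :
    SameCycle (attachInner σ i) (outer p j) (outer p k) ↔ SameCycle σ (outer p j) (outer p k) := by
  have h1 := h.not_sameCycle_inner hp
  have h2 := h.not_sameCycle_neg_inner hp
  have h3 := hf.not_sameCycle_inner_neg
  have h4 : ¬ SameCycle σ (outer p i) (-inner p) := fun t => h2 i t.symm
  have h5 : ¬ SameCycle σ (inner p) (-outer p i) := by
    rw [neg_outer hp]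
    exact h1 _
  rw [sameCycle_attachInner_iff hp hf]
  simp only [joinSetoid_apply, setoid_apply, h1, h2, h3, h4, h5, hn, or_false, false_and]
  constructor
  · rintro ((t | t) | t)
    · exact t
    · exact t.1.symm.trans t.2
    · exact t.1.symm.trans t.2
  · exact fun t => Or.inl (Or.inl t)

theorem sameCycle_attachInner_inner (hp : 1 ≤ p) (h : AbsLe σ (gamma p 1)) (hf : FixesInner σ)
    (hn : ¬ SameCycle σ (outer p i) (-outer p i)) (k : ℤ) :
    SameCycle (attachInner σ i) (inner p) (outer p k) ↔ SameCycle σ (outer p i) (outer p k) := by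
  have h1 := h.not_sameCycle_inner hp
  have h2 := h.not_sameCycle_neg_inner hp
  have h3 := hf.not_sameCycle_inner_neg
  have h4 : ¬ SameCycle σ (outer p i) (-inner p) := fun t => h2 i t.symm
  have h5 : ¬ SameCycle σ (inner p) (-outer p i) := by
    rw [neg_outer hp]
    exact h1 _
  rw [sameCycle_attachInner_iff hp hf]
  have h6 : ¬ SameCycle σ (-outer p i) (inner p) := fun t => h5 t.symm
  have h7 : ¬ SameCycle σ (-inner p) (inner p) := fun t => h3 t.symm
  simp only [joinSetoid_apply, setoid_apply, h1, h2, h3, h4, h5, h6, h7, hn, or_false, false_and,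
    SameCycle.refl, or_true, true_and, false_or]

theorem not_sameCycle_attachInner_neg (hp : 1 ≤ p) (h : AbsLe σ (gamma p 1)) (hf : FixesInner σ)
    (hn : ¬ SameCycle σ (outer p i) (-outer p i)) :
    ¬ SameCycle (attachInner σ i) (inner p) (-inner p) := by
  have h1 := h.not_sameCycle_inner hp
  have h2 := h.not_sameCycle_neg_inner hp
  have h3 := hf.not_sameCycle_inner_neg
  have h4 : ¬ SameCycle σ (outer p i) (-inner p) := fun t => h2 i t.symm
  have h5 : ¬ SameCycle σ (inner p) (-outer p i) := by
    rw [neg_outer hp]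
    exact h1 _
  have h6 : ¬ SameCycle σ (-outer p i) (inner p) := fun t => h5 t.symm
  have h7 : ¬ SameCycle σ (-inner p) (inner p) := fun t => h3 t.symm
  rw [sameCycle_attachInner_iff hp hf]
  simp [joinSetoid_apply, setoid_apply, h3, h4, h5, h6, h7, hn]

theorem omegaTilde_attachInner_outer (hp : 1 ≤ p) (h : AbsLe σ (gamma p 1))
    (hσ : σ ∈ hyperoctahedral (p + 1)) (hf : FixesInner σ)
    (hn : ¬ SameCycle σ (outer p i) (-outer p i)) (j k : ℤ) :
    omegaTilde (attachInner σ i) (outer p j) (outer p k) ↔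
      SameCycle σ (outer p j) (outer p k) := by
  have hτ : attachInner σ i ∈ hyperoctahedral (p + 1) :=
    mul_mem_hyperoctahedral hσ (swap_mul_swap_mem_hyperoctahedral (outer_ne_neg_inner i hp))
  rw [omegaTilde_apply hτ, neg_outer hp, neg_outer hp, sameCycle_attachInner_outer hp h hf hn,
    sameCycle_attachInner_outer hp h hf hn, sameCycle_attachInner_outer hp h hf hn,
    ← neg_outer hp, ← neg_outer hp]
  exact ⟨fun t => t.elim id fun t => (h.noncrossing hp).rel_of_zero hp t.1 t.2, Or.inl⟩

theorem omegaTilde_attachInner_inner (hp : 1 ≤ p) (h : AbsLe σ (gamma p 1))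
    (hσ : σ ∈ hyperoctahedral (p + 1)) (hf : FixesInner σ)
    (hn : ¬ SameCycle σ (outer p i) (-outer p i)) (k : ℤ) :
    omegaTilde (attachInner σ i) (inner p) (outer p k) ↔ SameCycle σ (outer p i) (outer p k) := by
  have hτ : attachInner σ i ∈ hyperoctahedral (p + 1) :=
    mul_mem_hyperoctahedral hσ (swap_mul_swap_mem_hyperoctahedral (outer_ne_neg_inner i hp))
  rw [omegaTilde_apply hτ, sameCycle_attachInner_inner hp h hf hn]
  simp [not_sameCycle_attachInner_neg hp h hf hn]

theorem not_omegaTilde_attachInner_neg (hp : 1 ≤ p) (h : AbsLe σ (gamma p 1))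
    (hσ : σ ∈ hyperoctahedral (p + 1)) (hf : FixesInner σ)
    (hn : ¬ SameCycle σ (outer p i) (-outer p i)) :
    ¬ omegaTilde (attachInner σ i) (inner p) (-inner p) := by
  have hτ : attachInner σ i ∈ hyperoctahedral (p + 1) :=
    mul_mem_hyperoctahedral hσ (swap_mul_swap_mem_hyperoctahedral (outer_ne_neg_inner i hp))
  rw [omegaTilde_apply hτ]
  simp [not_sameCycle_attachInner_neg hp h hf hn]

/-- By `AbsLe.mul_swap`, `σ * swap (outer p i) (-outer p i)` is again below `γ`. Its orbits give the
trace of the merged partition on the long cycle, which is therefore noncrossing. -/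
theorem AbsLe.isAdmissible_attachInner (hp : 1 ≤ p) (h : AbsLe σ (gamma p 1))
    (hσ : σ ∈ hyperoctahedral (p + 1)) (hf : FixesInner σ)
    (hi : SameCycle (σ⁻¹ * gamma p 1) (outer p i) (-outer p i)) :
    IsAdmissible p (omegaTilde (attachInner σ i)) := by
  have hτ : attachInner σ i ∈ hyperoctahedral (p + 1) :=
    mul_mem_hyperoctahedral hσ (swap_mul_swap_mem_hyperoctahedral (outer_ne_neg_inner i hp))
  obtain ⟨hn, h'⟩ := h.mul_swap hi (SignedSet.neg_ne_self _).symm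
  have hout := omegaTilde_attachInner_outer hp h hσ hf hn
  have hinn := omegaTilde_attachInner_inner hp h hσ hf hn
  have hinn' : ∀ k, omegaTilde (attachInner σ i) (-inner p) (outer p k) ↔
      SameCycle σ (-outer p i) (outer p k) := by
    intro k
    have e : outer p k = -outer p (k + p) := by rw [outer_add hp, SignedSet.neg_neg]
    rw [e]
    constructor
    · intro t
      have := omegaTilde_neg hτ t
      rw [SignedSet.neg_neg, SignedSet.neg_neg, hinn] at this
      exact sameCycle_neg_neg hσ this
    · intro t
      have := sameCycle_neg_neg hσ t
      rw [SignedSet.neg_neg, SignedSet.neg_neg, ← hinn] at this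
      exact omegaTilde_neg hτ this
  refine ⟨fun x y => omegaTilde_neg hτ, fun x y => omegaTilde_zero hτ,
    (h.noncrossing hp).congr hout, (h'.noncrossing hp).congr fun j k => ?_⟩
  rw [sameCycle_setoid_mul_swap hn, joinSetoid_apply, joinSetoid_apply, hout, hinn, hinn, hinn',
    hinn']
  rfl

end Attach

theorem isAdmissible_omegaTilde (hp : 1 ≤ p) {τ : Perm (SignedSet (p + 1))}
    (h : τ ∈ ncPermsB p 1) : IsAdmissible p (omegaTilde τ) := by
  rcases absLe_or_exists_attachInner hp h with h' | ⟨σ, i, h1, h2, h3, h4, rfl⟩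
  · exact h'.isAdmissible hp h.2
  · exact h1.isAdmissible_attachInner hp h2 h3 h4

theorem setoid_eq_of_outer (hp : 1 ≤ p) {r s : Setoid (SignedSet (p + 1))}
    (hr : ∀ ⦃x y⦄, r x y → r (-x) (-y)) (hs : ∀ ⦃x y⦄, s x y → s (-x) (-y))
    (h1 : ∀ i j, r (outer p i) (outer p j) ↔ s (outer p i) (outer p j))
    (h2 : ∀ j, r (inner p) (outer p j) ↔ s (inner p) (outer p j))
    (h3 : r (inner p) (-inner p) ↔ s (inner p) (-inner p)) : r = s := by
  have key : ∀ {r s : Setoid (SignedSet (p + 1))}, (∀ ⦃x y⦄, r x y → r (-x) (-y)) →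
      (∀ ⦃x y⦄, s x y → s (-x) (-y)) →
      (∀ i j, r (outer p i) (outer p j) → s (outer p i) (outer p j)) →
      (∀ j, r (inner p) (outer p j) → s (inner p) (outer p j)) →
      (r (inner p) (-inner p) → s (inner p) (-inner p)) → r ≤ s := by
    clear! r s
    intro r s hr hs h1 h2 h3
    have h2' : ∀ j, r (-inner p) (outer p j) → s (-inner p) (outer p j) := by
      intro j t
      have t' := hr t
      rw [SignedSet.neg_neg, neg_outer hp] at t'
      have t'' := hs (h2 _ t')
      rwa [← neg_outer hp, SignedSet.neg_neg] at t''
    intro x y t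
    rcases eq_inner_or_outer hp x with rfl | rfl | ⟨i, rfl⟩ <;>
      rcases eq_inner_or_outer hp y with rfl | rfl | ⟨j, rfl⟩
    · exact s.refl _
    · exact h3 t
    · exact h2 j t
    · exact s.symm (h3 (r.symm t))
    · exact s.refl _
    · exact h2' j t
    · exact s.symm (h2 i (r.symm t))
    · exact s.symm (h2' i (r.symm t))
    · exact h1 i j t
  exact le_antisymm
    (key hr hs (fun i j => (h1 i j).mp) (fun j => (h2 j).mp) h3.mp)
    (key hs hr (fun i j => (h1 i j).mpr) (fun j => (h2 j).mpr) h3.mpr)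

theorem IsAdmissible.exists_omegaTilde_eq (hp : 1 ≤ p) {π : Setoid (SignedSet (p + 1))}
    (h : IsAdmissible p π) : ∃ τ ∈ ncPermsB p 1, omegaTilde τ = π := by
  obtain ⟨σ, h1, hσ, hf, hout⟩ := h.noncrossing.exists_absLe hp h.neg
  have hzero : ∀ k, SameCycle σ (outer p k) (-outer p k) ↔ π (outer p k) (-outer p k) := by
    intro k
    rw [neg_outer hp, hout]
  have hσi := h1.not_sameCycle_inner hp
  by_cases hz : π (inner p) (-inner p)
  -- Here `inner p` is in the zero-block. Making the short cycle an orbit suffices, since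
  -- `omegaTilde` merges it with the symmetric orbit on the long cycle, if any.
  · have hκ := sameCycle_self_neg_of_apply hf.complement_inner.1
    obtain ⟨hn, h2⟩ := h1.mul_swap hκ (SignedSet.neg_ne_self _).symm
    have hτ := mul_mem_hyperoctahedral hσ (swap_neg_mem_hyperoctahedral (inner p))
    have hσi' := h1.not_sameCycle_neg_inner hp
    have hsc : ∀ u v, SameCycle (σ * swap (inner p) (-inner p)) u v ↔
        joinSetoid (SameCycle.setoid σ) (inner p) (-inner p) u v := fun u v => by
      rw [← sameCycle_setoid_mul_swap hn]
      rfl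
    have hout' : ∀ i j, SameCycle (σ * swap (inner p) (-inner p)) (outer p i) (outer p j) ↔
        π (outer p i) (outer p j) := fun i j => by
      rw [hsc, joinSetoid_apply, setoid_apply, hout]
      simp [setoid_apply, hσi, hσi']
    have hz' : SameCycle (σ * swap (inner p) (-inner p)) (inner p) (-inner p) :=
      (hsc _ _).mpr (joinSetoid_rel _ _ _)
    refine ⟨_, ⟨h2.mem_ncPerms, hτ⟩,
      setoid_eq_of_outer hp (fun x y => omegaTilde_neg hτ) h.neg (fun i j => ?_) (fun j => ?_) ?_⟩
    · rw [omegaTilde_apply hτ, neg_outer hp, neg_outer hp, hout', hout', hout', ← neg_outer hp,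
        ← neg_outer hp]
      exact ⟨fun t => t.elim id fun t => h.zero t.1 t.2, Or.inl⟩
    · have hj : ¬ SameCycle (σ * swap (inner p) (-inner p)) (inner p) (outer p j) := by
        simp [hsc, joinSetoid_apply, setoid_apply, hσi, hσi']
      rw [omegaTilde_apply hτ, neg_outer hp, hout', ← neg_outer hp]
      simp only [hj, hz', true_and, false_or]
      exact ⟨fun t => h.zero hz t, fun t => π.trans (π.symm t) (π.trans hz (h.neg t))⟩
    · exact iff_of_true (Or.inl hz') hz
  by_cases hk : ∃ k, π (inner p) (outer p k)
  · obtain ⟨k, hk⟩ := hk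
    have hk' : π (-inner p) (outer p (k + p)) := by
      rw [← neg_outer hp]
      exact h.neg hk
    have hle : SameCycle.setoid σ ≤ joinSetoid π (inner p) (-inner p) := by
      intro u v t
      rcases hf.sameCycle_cases hp t with rfl | ⟨i, j, rfl, rfl⟩
      · exact Setoid.refl' _ _
      · exact Or.inl ((hout i j).mp t)
    -- The merged partition is noncrossing and strictly coarser than `σ` on the long cycle, so some
    -- complement cycle joins a point of the block of `inner p` to one of the block of `-inner p`.
    -- That cycle is symmetric by `AbsLe.sameCycle_complement_neg`, and gives the place to attach.
    obtain ⟨i, hi, hκ⟩ : ∃ i, π (inner p) (outer p i) ∧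
        SameCycle (σ⁻¹ * gamma p 1) (outer p i) (-outer p i) := by
      obtain ⟨i, j, hij, hn, hκ⟩ := h.noncrossing_join.exists_sameCycle_complement hp hf hle
        (i₀ := k) (j₀ := k + p) (Or.inr ⟨Or.inl hk, Or.inr hk'⟩)
        (fun t => hz (π.trans hk (π.trans ((hout _ _).mp t) (π.symm hk'))))
      have hne : outer p i ≠ outer p j := fun e => hn (e ▸ SameCycle.refl _ _)
      have key : ∀ {i j : ℤ}, π (inner p) (outer p i) → π (-inner p) (outer p j) →
          SameCycle σ (outer p i) (-outer p j) := by
        intro i j hi hj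
        have hj' := h.neg hj
        rw [SignedSet.neg_neg, neg_outer hp] at hj'
        rw [neg_outer hp, hout]
        exact π.trans (π.symm hi) hj'
      rw [hout] at hn
      rcases hij with t | ⟨t | t, t' | t'⟩
      · exact absurd t hn
      · exact absurd (π.trans (π.symm t) t') hn
      · exact ⟨i, t, h1.sameCycle_complement_neg (gamma_mem_hyperoctahedral p) hσ hκ hne
          (key t t')⟩
      · exact ⟨j, t', h1.sameCycle_complement_neg (gamma_mem_hyperoctahedral p) hσ hκ.symm hne.symm
          (key t' t)⟩
      · exact absurd (π.trans (π.symm t) t') hn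
    have hn := (h1.mul_swap hκ (SignedSet.neg_ne_self _).symm).1
    have hτ := attachInner_mem_ncPermsB hp h1 hσ hf hκ
    refine ⟨_, hτ, setoid_eq_of_outer hp (fun x y => omegaTilde_neg hτ.2) h.neg
      (fun j k => ?_) (fun k => ?_) ?_⟩
    · rw [omegaTilde_attachInner_outer hp h1 hσ hf hn, hout]
    · rw [omegaTilde_attachInner_inner hp h1 hσ hf hn, hout]
      exact ⟨fun t => π.trans hi t, fun t => π.trans (π.symm hi) t⟩
    · exact iff_of_false (not_omegaTilde_attachInner_neg hp h1 hσ hf hn) hz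
  -- In the remaining case `{inner p}` and `{-inner p}` are singleton blocks.
  · push Not at hk
    refine ⟨σ, ⟨h1.mem_ncPerms, hσ⟩,
      setoid_eq_of_outer hp (fun x y => omegaTilde_neg hσ) h.neg (fun i j => ?_) (fun j => ?_) ?_⟩
    · rw [omegaTilde_apply hσ, hout, hzero, hzero]
      exact ⟨fun t => t.elim id fun t => h.zero t.1 t.2, Or.inl⟩
    · rw [omegaTilde_apply hσ]
      simp [hσi, hf.not_sameCycle_inner_neg, hk]
    · rw [omegaTilde_apply hσ]
      simp [hf.not_sameCycle_inner_neg, hz]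

end Admissible

/-! ### Stability of admissibility under intersection. -/

section Meet

variable {p : ℕ} {π ρ : Setoid (SignedSet (p + 1))}

theorem isAdmissible_top : IsAdmissible p ⊤ :=
  ⟨fun _ _ _ => trivial, fun _ _ _ _ => trivial, fun _ _ _ _ _ _ _ _ _ _ => trivial,
    fun _ _ _ _ _ _ _ _ _ _ => Or.inl trivial⟩

theorem Noncrossing.inf (hπ : Noncrossing p π) (hρ : Noncrossing p ρ) : Noncrossing p (π ⊓ ρ) :=
  fun _ _ _ _ h1 h2 h3 h4 h5 h6 =>
    ⟨hπ h1 h2 h3 h4 h5.1 h6.1, hρ h1 h2 h3 h4 h5.2 h6.2⟩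

/-- The opposite blocks of `c` and `-c` in `π` and in `ρ` cannot separate the long cycle in two
different directions. -/
theorem IsAdmissible.rel_neg_of_crossing (hp : 1 ≤ p) (hπ : IsAdmissible p π)
    (hρ : IsAdmissible p ρ) {c : SignedSet (p + 1)} {i j k l : ℤ} (hij : i < j) (hjk : j < k)
    (hkl : k < l) (hl : l < i + 2 * p) (hj : π c (outer p j)) (hk : π (-c) (outer p k))
    (hjl : π (outer p j) (outer p l)) (hi' : ρ c (outer p i)) (hj' : ρ (-c) (outer p j))
    (hjl' : ρ (outer p j) (outer p l)) : π c (-c) ∨ ρ c (-c) := by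
  have h1 := hπ.neg hj
  have h2 := hρ.neg hj'
  rw [neg_outer hp] at h1 h2
  rw [SignedSet.neg_neg] at h2
  -- The point `-j` sits at `j + p`, in the block of `-c` for `π` and of `c` for `ρ`. Beyond `l` it
  -- forces a crossing in `π`, before `l` one in `ρ`, and at `l` itself it puts `-c` in the block of
  -- `c` in `π`.
  rcases lt_trichotomy (j + p) l with h | h | h
  · right
    have h3 : ρ (outer p (j + p)) (outer p (i + 2 * p)) := by
      rw [outer_add_two_mul hp]
      exact ρ.trans (ρ.symm h2) hi'
    have h4 := hρ.noncrossing (by omega) h hl (by omega) hjl' h3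
    exact ρ.trans h2 (ρ.trans (ρ.symm h4) (ρ.symm hj'))
  · left
    rw [h] at h1
    exact π.trans hj (π.trans hjl (π.symm h1))
  · left
    have h4 := hπ.noncrossing hjk hkl h (by omega) hjl (π.trans (π.symm hk) h1)
    exact π.trans hj (π.trans h4 (π.symm hk))

theorem IsAdmissible.rel_or_rel_neg (hπ : IsAdmissible p π) {c : SignedSet (p + 1)}
    (hc : c = inner p ∨ c = -inner p) {i j k l : ℤ} (hij : i < j) (hjk : j < k)
    (hkl : k < l) (hl : l < i + 2 * p) (hi : π c (outer p i)) (hk : π (-c) (outer p k))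
    (hjl : π (outer p j) (outer p l)) : π c (outer p j) ∨ π (-c) (outer p j) := by
  have hM : ∀ {u}, π (inner p) u ∨ π (-inner p) u ↔ π c u ∨ π (-c) u := by
    rcases hc with rfl | rfl
    · exact Iff.rfl
    · rw [SignedSet.neg_neg]
      exact or_comm
  have h := hπ.noncrossing_join hij hjk hkl hl
    (Or.inr ⟨hM.mpr (Or.inl hi), hM.mpr (Or.inr hk)⟩) (Or.inl hjl)
  rcases h with t | ⟨-, t⟩
  · exact Or.inl (π.trans hi t)
  · exact hM.mp t

/-- Each partition puts `j` with `c` or with `-c`. If the signs disagree, `c` and `-c` are related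
in one of the two, whose sign may be switched to match the other. -/
theorem IsAdmissible.inf_rel_or_rel_neg (hp : 1 ≤ p) (hπ : IsAdmissible p π)
    (hρ : IsAdmissible p ρ) {c : SignedSet (p + 1)} (hc : c = inner p ∨ c = -inner p)
    {i j k l : ℤ} (hij : i < j) (hjk : j < k) (hkl : k < l) (hl : l < i + 2 * p)
    (hi : (π ⊓ ρ) c (outer p i)) (hk : (π ⊓ ρ) (-c) (outer p k))
    (hjl : (π ⊓ ρ) (outer p j) (outer p l)) :
    (π ⊓ ρ) c (outer p j) ∨ (π ⊓ ρ) (-c) (outer p j) := by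
  rcases hπ.rel_or_rel_neg hc hij hjk hkl hl hi.1 hk.1 hjl.1 with h1 | h1 <;>
    rcases hρ.rel_or_rel_neg hc hij hjk hkl hl hi.2 hk.2 hjl.2 with h2 | h2
  · exact Or.inl ⟨h1, h2⟩
  · rcases hπ.rel_neg_of_crossing hp hρ hij hjk hkl hl h1 hk.1 hjl.1 hi.2 h2 hjl.2 with t | t
    · exact Or.inr ⟨π.trans (π.symm t) h1, h2⟩
    · exact Or.inl ⟨h1, ρ.trans t h2⟩
  · rcases hρ.rel_neg_of_crossing hp hπ hij hjk hkl hl h2 hk.2 hjl.2 hi.1 h1 hjl.1 with t | t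
    · exact Or.inr ⟨h1, ρ.trans (ρ.symm t) h2⟩
    · exact Or.inl ⟨π.trans t h1, h2⟩
  · exact Or.inr ⟨h1, h2⟩

theorem IsAdmissible.inf_join_rel (hp : 1 ≤ p) (hπ : IsAdmissible p π) (hρ : IsAdmissible p ρ)
    {i j k l : ℤ} (hij : i < j) (hjk : j < k) (hkl : k < l) (hl : l < i + 2 * p)
    (hi : (π ⊓ ρ) (inner p) (outer p i) ∨ (π ⊓ ρ) (-inner p) (outer p i))
    (hk : (π ⊓ ρ) (inner p) (outer p k) ∨ (π ⊓ ρ) (-inner p) (outer p k))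
    (hjl : (π ⊓ ρ) (outer p j) (outer p l)) :
    joinSetoid (π ⊓ ρ) (inner p) (-inner p) (outer p i) (outer p j) := by
  have hnc := hπ.noncrossing.inf hρ.noncrossing
  have hi₀ := hi
  rcases hi with hi | hi <;> rcases hk with hk | hk
  · exact Or.inl (hnc hij hjk hkl hl ((π ⊓ ρ).trans ((π ⊓ ρ).symm hi) hk) hjl)
  · exact Or.inr ⟨hi₀, hπ.inf_rel_or_rel_neg hp hρ (Or.inl rfl) hij hjk hkl hl hi hk hjl⟩
  · have h := hπ.inf_rel_or_rel_neg hp hρ (Or.inr rfl) hij hjk hkl hl hi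
      (by rwa [SignedSet.neg_neg]) hjl
    rw [SignedSet.neg_neg] at h
    exact Or.inr ⟨hi₀, h.symm⟩
  · exact Or.inl (hnc hij hjk hkl hl ((π ⊓ ρ).trans ((π ⊓ ρ).symm hi) hk) hjl)

theorem IsAdmissible.inf (hp : 1 ≤ p) (hπ : IsAdmissible p π) (hρ : IsAdmissible p ρ) :
    IsAdmissible p (π ⊓ ρ) := by
  refine ⟨fun x y h => ⟨hπ.neg h.1, hρ.neg h.2⟩,
    fun x y h h' => ⟨hπ.zero h.1 h'.1, hρ.zero h.2 h'.2⟩, hπ.noncrossing.inf hρ.noncrossing, ?_⟩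
  intro i j k l hij hjk hkl hl hik hjl
  rcases hik with h | ⟨h, h'⟩ <;> rcases hjl with t | ⟨t, t'⟩
  · exact Or.inl (hπ.noncrossing.inf hρ.noncrossing hij hjk hkl hl h t)
  -- The merged pair is now `j, l`; rotating to `j < k < l < i + 2 * p` brings it into first and
  -- third position.
  · have h2 : (π ⊓ ρ) (outer p k) (outer p (i + 2 * p)) := by
      rw [outer_add_two_mul hp]
      exact (π ⊓ ρ).symm h
    exact (joinSetoid _ _ _).trans (Or.inl h) ((joinSetoid _ _ _).symm
      (hπ.inf_join_rel hp hρ hjk hkl hl (by omega) t t' h2))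
  · exact hπ.inf_join_rel hp hρ hij hjk hkl hl h h' t
  · exact Or.inr ⟨h, t⟩

end Meet

/-! ### From meets to the lattice. -/

section Lattice

theorem exists_lattice_of_forall_isGLB {α : Type*} [P : PartialOrder α]
    (h : ∀ s : Set α, ∃ g, IsGLB s g) :
    ∃ L : Lattice α, L.toSemilatticeInf.toPartialOrder = P ∧
      ∀ a b g : α, IsGLB {a, b} g → L.inf a b = g := by
  let : InfSet α := ⟨fun s => (h s).choose⟩
  let C : CompleteLattice α := completeLatticeOfInf α fun s => (h s).choose_spec
  refine ⟨C.toLattice, rfl, fun a b g hg => ?_⟩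
  exact IsGLB.unique (isGLB_pair (a := a) (b := b)) hg

variable {p : ℕ}

instance instFiniteNCB (p q : ℕ) : Finite (NCB p q) := by
  have : Finite (Setoid (SignedSet (p + q))) :=
    Finite.of_injective (fun (r : Setoid (SignedSet (p + q))) x y => r x y) fun r s h =>
      Setoid.ext fun x y => iff_of_eq (congrFun (congrFun h x) y)
  exact Subtype.finite

theorem NCB.isAdmissible (hp : 1 ≤ p) (π : NCB p 1) : IsAdmissible p π.1 := by
  obtain ⟨τ, hτ, e⟩ := π.2
  exact e ▸ isAdmissible_omegaTilde hp hτ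

theorem NCB.le_iff {q : ℕ} {π ρ : NCB p q} : π ≤ ρ ↔ π.1 ≤ ρ.1 := revRefines_iff_le _ _

theorem NCB.exists_isGLB_pair (hp : 1 ≤ p) (π ρ : NCB p 1) :
    ∃ g : NCB p 1, g.1 = π.1 ⊓ ρ.1 ∧ IsGLB {π, ρ} g := by
  refine ⟨⟨π.1 ⊓ ρ.1, ((π.isAdmissible hp).inf hp (ρ.isAdmissible hp)).exists_omegaTilde_eq hp⟩,
    rfl, ?_, fun σ hσ => ?_⟩
  · rintro σ (rfl | rfl)
    · exact NCB.le_iff.mpr inf_le_left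
    · exact NCB.le_iff.mpr inf_le_right
  · exact NCB.le_iff.mpr (le_inf (NCB.le_iff.mp (hσ (Or.inl rfl)))
      (NCB.le_iff.mp (hσ (Or.inr rfl))))

/-- Finiteness reduces arbitrary infima to binary ones and to the one-block partition for the empty
set; joins are then infima of sets of upper bounds. -/
theorem NCB.exists_isGLB (hp : 1 ≤ p) (s : Set (NCB p 1)) : ∃ g, IsGLB s g := by
  induction s, s.toFinite using Set.Finite.induction_on with
  | empty =>
    exact ⟨⟨⊤, isAdmissible_top.exists_omegaTilde_eq hp⟩,
      isGLB_empty_iff.mpr fun σ => NCB.le_iff.mpr le_top⟩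
  | @insert a s _ _ ih =>
    obtain ⟨g, hg⟩ := ih
    obtain ⟨g', -, hg'⟩ := NCB.exists_isGLB_pair hp a g
    refine ⟨g', ?_, fun b hb => hg'.2 ?_⟩
    · rintro b (rfl | hb)
      · exact hg'.1 (Or.inl rfl)
      · exact (hg'.1 (Or.inr rfl)).trans (hg.1 hb)
    · rintro c (rfl | rfl)
      · exact hb (Or.inl rfl)
      · exact hg.2 fun d hd => hb (Or.inr hd)

theorem classes_inf {X : Type*} (π ρ : Setoid X) :
    (π ⊓ ρ).classes = {C | C.Nonempty ∧ ∃ A ∈ π.classes, ∃ B ∈ ρ.classes, C = A ∩ B} := by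
  ext C
  constructor
  · rintro ⟨x, rfl⟩
    exact ⟨⟨x, (π ⊓ ρ).refl x⟩, _, Setoid.mem_classes π x, _, Setoid.mem_classes ρ x, rfl⟩
  · rintro ⟨⟨x, hx⟩, _, ⟨a, rfl⟩, _, ⟨b, rfl⟩, rfl⟩
    refine ⟨x, Set.ext fun y => ?_⟩
    exact ⟨fun h => ⟨π.trans h.1 (π.symm hx.1), ρ.trans h.2 (ρ.symm hx.2)⟩,
      fun h => ⟨π.trans h.1 hx.1, ρ.trans h.2 hx.2⟩⟩

end Lattice

end AnnularB

theorem theorem1p5 (n : ℕ) (hn : 2 ≤ n) :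
    ∃ L : Lattice (AnnularB.NCB (n - 1) 1),
      L.toSemilatticeInf.toPartialOrder = AnnularB.instPartialOrderNCB (n - 1) 1 ∧
      ∀ π ρ : AnnularB.NCB (n - 1) 1,
        (L.inf π ρ).1 = π.1 ⊓ ρ.1 ∧
        (L.inf π ρ).1.classes =
          {C | C.Nonempty ∧ ∃ A ∈ π.1.classes, ∃ B ∈ ρ.1.classes, C = A ∩ B} := by
  have hp : 1 ≤ n - 1 := by omega
  obtain ⟨L, hL, hinf⟩ := AnnularB.exists_lattice_of_forall_isGLB (AnnularB.NCB.exists_isGLB hp)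
  refine ⟨L, hL, fun π ρ => ?_⟩
  obtain ⟨g, hg, hglb⟩ := AnnularB.NCB.exists_isGLB_pair hp π ρ
  have e : (L.inf π ρ).1 = π.1 ⊓ ρ.1 := by rw [hinf π ρ g hglb, hg]
  exact ⟨e, by rw [e, AnnularB.classes_inf]⟩
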